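/- **The model.** In the Quantum Congested Clique there are $n$ nodes, numbered $0,\dots,n-1$; the input is a graph $G$ on the set of nodes, and each node initially knows $n$, its own number and its set of neighbours in $G$. Each node holds a private quantum workspace of arbitrary finite dimension and, for every node of the network, a message register of $O(\log n)$ qubits. Initially all registers are in fixed basis states, so that the nodes share no entanglement. In each synchronous round, every node applies an arbitrary unitary (depending on $n$, its number, its neighbourhood and the round) to the registers it holds, and then every node $u$ sends to every node $v$ the message register it holds for $v$. After the last round each node applies one more unitary to its registers and measures them, and outputs ``yes'' or ``no'' depending on the outcome. The complexity of an algorithm is its number $T(n)$ of rounds, which depends only on $n$; local computation is free, and there may be a different protocol for each $n$. **The problem.** In $p$-clique detection, if $G$ contains a $p$-clique then at least one node must output ``yes''; otherwise all nodes must output ``no''. An algorithm solves the problem with success probability at least $q$ if, on every input graph $G$, this holds with probability at least $q$ over the outcomes of the measurements. **Theorem.** Let $p\ge 3$ and $k\ge 0$ be integers, and let the message registers consist of $c\lceil\log_2 n\rceil$ qubits for an integer constant $c\ge 1$. There exists a quantum algorithm in the Quantum Congested Clique that solves $p$-clique detection, for all $n\ge 1$, with success probability at least $1-1/n^{k}$,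 and whose complexity is $\tilde O(n^{1/5})$ if $p=3$ and $\tilde O(n^{1-2/(p-1)})$ if $p\ge 4$. Here $\tilde O(g(n))$ means $O(g(n)(\log n)^d)$ for some constant $d$; the constants hidden in the bound may depend on $p$, $k$ and $c$, but not on $n$ or $G$. -/

import Mathlib

open scoped Matrix

noncomputable section

namespace QCC

/-- The content (in the computational basis) of one message register of `b` qubits. -/
abbrev Message (b : ℕ) : Type := Fin b → Bool

/-- A basis state of everything that one node holds: its private workspace, with basis `W`, and
one message register of `b` qubits for each of the `n` nodes. -/
abbrev Local (n b : ℕ) (W : Type) : Type := W × (Fin n → Message b)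

/-- A basis state of the whole network of `n` nodes. The Hilbert space of the network is the
tensor product of the Hilbert spaces of the nodes, that is, `Config n b W → ℂ`. -/
abbrev Config (n b : ℕ) (W : Type) : Type := Fin n → Local n b W

/-- A protocol for `n` nodes in the Quantum Congested Clique with messages of `b` qubits.
The nodes are `0, …, n - 1`, and each node knows `n`, its own number and its own input, which is
its set of neighbours in the input graph. Local computation is free: a node may apply any unitary
to the registers it holds, and its workspace may be any finite-dimensional system. -/
structure Protocol (n b : ℕ) where
  /-- The computational basis of the private workspace of a node. -/
  Work : Type
  [fintypeWork : Fintype Work]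
  [decidableEqWork : DecidableEq Work]
  /-- The initial basis state of the workspace. -/
  init : Work
  /-- The number of communication rounds. -/
  rounds : ℕ
  /-- `op v N t` is the unitary that node `v` with neighbour set `N` applies to its own registers
  after `t` rounds of communication (for `t = rounds`: before the final measurement). -/
  op : Fin n → Set (Fin n) → ℕ → Matrix.unitaryGroup (Local n b Work) ℂ
  /-- The output (`true` is "yes") that node `v` with neighbour set `N` derives from the outcome
  of the measurement of its own registers. -/
  out : Fin n → Set (Fin n) → Local n b Work → Bool

attribute [instance] Protocol.fintypeWork Protocol.decidableEqWork

/-- One round of communication, on basis states: for every ordered pair `(u, v)`, the register that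
`u` holds for `v` travels to `v`, where it becomes the register that `v` holds for `u`. -/
def exchange {n b : ℕ} {W : Type} (x : Config n b W) : Config n b W :=
  fun v => ((x v).1, fun u => (x u).2 v)

namespace Protocol

variable {n b : ℕ}

/-- The initial basis state: all registers are in their fixed initial states, in particular the
nodes share no entanglement. -/
def initConfig (P : Protocol n b) : Config n b P.Work :=
  fun _ => (P.init, fun _ _ => false)

/-- The tensor product, over all nodes `v`, of the unitaries that the nodes apply locally after `t`
rounds when the input graph is `G`. -/
def localStep (P : Protocol n b) (G : SimpleGraph (Fin n)) (t : ℕ) :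
    Matrix (Config n b P.Work) (Config n b P.Work) ℂ :=
  Matrix.of fun x y => ∏ v, (P.op v (G.neighborSet v) t : Matrix _ _ ℂ) (x v) (y v)

/-- The state of the network right after `t` rounds on input `G`. Each round consists of local
unitaries followed by an exchange of messages; as `exchange` is an involution, it maps the state
`φ` to `φ ∘ exchange`. -/
def state (P : Protocol n b) (G : SimpleGraph (Fin n)) : ℕ → Config n b P.Work → ℂ
  | 0 => Pi.single P.initConfig 1
  | t + 1 => fun x => (P.localStep G t *ᵥ P.state G t) (exchange x)

/-- The state of the network just before the final measurement. -/
def finalState (P : Protocol n b) (G : SimpleGraph (Fin n)) : Config n b P.Work → ℂ :=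
  P.localStep G P.rounds *ᵥ P.state G P.rounds

/-- The outputs of the nodes when the final measurement of all registers gives `x`. -/
def outputs (P : Protocol n b) (G : SimpleGraph (Fin n)) (x : Config n b P.Work) :
    Fin n → Bool :=
  fun v => P.out v (G.neighborSet v) (x v)

open Classical in
/-- The probability that the vector of the outputs of all nodes lies in `E` (Born rule). -/
def outputProb (P : Protocol n b) (G : SimpleGraph (Fin n)) (E : Set (Fin n → Bool)) : ℝ :=
  ∑ x with P.outputs G x ∈ E, ‖P.finalState G x‖ ^ 2

end Protocol

/-- The correct output vectors for `p`-clique detection on `G`: if `G` contains a `p`-clique then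
at least one node says yes, and otherwise all nodes say no. -/
def correctOutputs {n : ℕ} (p : ℕ) (G : SimpleGraph (Fin n)) : Set (Fin n → Bool) :=
  {o | (¬ G.CliqueFree p → ∃ v, o v = true) ∧ (G.CliqueFree p → ∀ v, o v = false)}

/-- `f = Õ(g)`: `f(n)` is at most `g(n)` up to a factor polylogarithmic in `n`. -/
def IsSoftO (f g : ℕ → ℝ) : Prop :=
  ∃ d : ℕ, f =O[Filter.atTop] fun n => g n * Real.log n ^ d

/-- In the Quantum Congested Clique, `p`-clique detection has complexity `Õ(g)` with success
probability `1 - 1 / poly(n)`. The model has messages of `O(log n)` qubits, and the claim is made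
for every constant `c ≥ 1` in this `O`, and for every degree `k` of the polynomial. The family `A`
has one protocol for each number of nodes, which has to be correct on every input graph. -/
def CliqueDetectionIn (p : ℕ) (g : ℕ → ℝ) : Prop :=
  ∀ c : ℕ, 1 ≤ c → ∀ k : ℕ, ∃ A : (n : ℕ) → Protocol n (c * Nat.clog 2 n),
    (∀ n : ℕ, 1 ≤ n → ∀ G : SimpleGraph (Fin n),
      1 - 1 / (n : ℝ) ^ k ≤ (A n).outputProb G (correctOutputs p G)) ∧
    IsSoftO (fun n => ((A n).rounds : ℝ)) g

end QCC

end

noncomputable section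

namespace QCC

/-! A `p`-clique is a set of `p - 1` nodes plus one further node `w`. Cut the node set into about
`n^α` parts. Network node `u` stands for a choice of `p - 1` parts, with union `S u` of size
`O(n^(1-α))`, and of one of about `n^γ` chunks of candidates for `w`; there are enough nodes if
`(p-1)α + γ ≤ 1`. Each chunk is cut further into about `n^κ` batches. Once and for all, `u` learns
the edges inside `S u`. Then a leader runs a Grover search over the batch index `j`: in one query it
broadcasts `j`, each `u` learns the edges between `S u` and its `j`-th batch, and reports whether
these complete a clique. Some `j` yields a positive report exactly if a `p`-clique exists
(`exists_cliqueFound_iff`, `exists_protocol_of_parts`).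

Cost: if every node sends and receives at most `D` bits, greedy edge colouring routes them through
relays in `O(D/n + 1)` rounds (`exists_isRouting`). So the preparation takes `O(n^(1-2α) + 1)`
rounds, a query takes `O(1)` rounds if `α + γ + κ ≥ 1`, and up to logarithms `n^(κ/2)` queries are
made. The theorem follows by choosing exponents in `cliqueDetectionIn_of_exponents`.

Quantum part: a classical program that stores all received messages in clean memory slots is
reversible, so the network can compute an answer, let the leader act on its own register depending
on the answer, and uncompute. The net effect is a unitary on the leader's register alone
(`simulates_query`), and Grover search can be analysed there. Since the number of marked batches is
unknown, the search is run with rotations by `3^e` times the basic angle; some `e` fails with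
probability at most `1/2` (`exists_cos_sq_le`). Each `e` is repeated `O(log n)` times in separate
registers, measured only at the end, so the failure probabilities multiply. Without a clique the
error is zero. -/

/-- The tensor product of a finite family of matrices. -/
def piMatrix {ι K : Type*} [Fintype ι] (B : ι → Matrix K K ℂ) : Matrix (ι → K) (ι → K) ℂ :=
  Matrix.of fun x y => ∏ i, B i (x i) (y i)

/-! ### Tensor products of matrices and elementary unitaries -/

section Tensor

variable {ι K : Type*} [Fintype ι] [DecidableEq ι] [Fintype K] [DecidableEq K]

omit [DecidableEq ι] [Fintype K] in
lemma piMatrix_one : piMatrix (fun _ : ι => (1 : Matrix K K ℂ)) = 1 := by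
  ext x y
  by_cases h : x = y
  · subst h; simp [piMatrix]
  · obtain ⟨i, hi⟩ := Function.ne_iff.mp h
    rw [Matrix.one_apply_ne h]
    exact Finset.prod_eq_zero (Finset.mem_univ i) (Matrix.one_apply_ne hi)

omit [DecidableEq K] in
lemma piMatrix_mul (B C : ι → Matrix K K ℂ) :
    piMatrix B * piMatrix C = piMatrix (fun i => B i * C i) := by
  ext x y
  simp only [piMatrix, Matrix.mul_apply, Matrix.of_apply, ← Finset.prod_mul_distrib]
  rw [Finset.prod_univ_sum, Fintype.piFinset_univ]

omit [DecidableEq ι] [Fintype K] [DecidableEq K] in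
lemma star_piMatrix (B : ι → Matrix K K ℂ) :
    star (piMatrix B) = piMatrix (fun i => star (B i)) := by
  ext x y
  simp [piMatrix, Matrix.star_apply]

lemma piMatrix_mem_unitaryGroup (B : ι → Matrix K K ℂ)
    (h : ∀ i, B i ∈ Matrix.unitaryGroup K ℂ) :
    piMatrix B ∈ Matrix.unitaryGroup (ι → K) ℂ := by
  rw [Matrix.mem_unitaryGroup_iff, star_piMatrix, piMatrix_mul]
  simp only [fun i => Matrix.mem_unitaryGroup_iff.mp (h i), piMatrix_one]

omit [DecidableEq K] in
lemma piMatrix_mulVec_prod (B : ι → Matrix K K ℂ) (φ : ι → K → ℂ) :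
    piMatrix B *ᵥ (fun x => ∏ i, φ i (x i)) = fun x => ∏ i, (B i *ᵥ φ i) (x i) := by
  ext x
  simp only [piMatrix, Matrix.mulVec, dotProduct, Matrix.of_apply, ← Finset.prod_mul_distrib]
  rw [Finset.prod_univ_sum, Fintype.piFinset_univ]

omit [DecidableEq ι] [Fintype K] in
lemma single_eq_prod (a : ι → K) :
    (Pi.single a 1 : (ι → K) → ℂ) = fun x => ∏ i, (Pi.single (a i) 1 : K → ℂ) (x i) := by
  ext x
  by_cases h : x = a
  · subst h; simp
  · obtain ⟨i, hi⟩ := Function.ne_iff.mp h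
    rw [Pi.single_eq_of_ne h, Finset.prod_eq_zero (Finset.mem_univ i)]
    exact Pi.single_eq_of_ne hi _

lemma piMatrix_mulVec_single (B : ι → Matrix K K ℂ) (a : ι → K) :
    piMatrix B *ᵥ Pi.single a 1 = fun x => ∏ i, B i (x i) (a i) := by
  rw [single_eq_prod, piMatrix_mulVec_prod]
  simp

/-- The unitary that permutes the computational basis. -/
def permUnitary (σ : Equiv.Perm K) : Matrix.unitaryGroup K ℂ :=
  ⟨Matrix.of fun x y => if x = σ y then 1 else 0, by
    rw [Matrix.mem_unitaryGroup_iff']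
    ext x y
    simp [Matrix.mul_apply, Matrix.star_apply, Matrix.one_apply, eq_comm]⟩

/-- The unitary on a first system that is controlled by a second system. -/
def controlled {C : Type*} [Fintype C] [DecidableEq C] (U : C → Matrix.unitaryGroup K ℂ) :
    Matrix.unitaryGroup (K × C) ℂ :=
  ⟨Matrix.blockDiagonal fun c => (U c : Matrix K K ℂ), by
    rw [Matrix.mem_unitaryGroup_iff, Matrix.star_eq_conjTranspose,
      Matrix.blockDiagonal_conjTranspose, ← Matrix.blockDiagonal_mul]
    simp only [← Matrix.star_eq_conjTranspose, fun c => Matrix.mem_unitaryGroup_iff.mp (U c).2]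
    exact Matrix.blockDiagonal_one⟩

/-- The unitary on a first system that is controlled by the rest of a local state. -/
def controlledLocal {C D : Type*} [Fintype C] [DecidableEq C] [Fintype D] [DecidableEq D]
    (U : C → Matrix.unitaryGroup K ℂ) : Matrix.unitaryGroup ((K × C) × D) ℂ :=
  ⟨Matrix.blockDiagonal fun _ : D => (controlled U : Matrix (K × C) (K × C) ℂ),
    (controlled fun _ : D => controlled U).2⟩

end Tensor

/-! ### Sequences of rounds and the transformations they implement -/

section Network

variable {n b : ℕ} {W : Type}

lemma exchange_exchange (x : Config n b W) : exchange (exchange x) = x := rfl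

variable [Fintype W] [DecidableEq W]

/-- A unitary for every node, depending on its number and its neighbourhood. -/
abbrev LocalOps (n b : ℕ) (W : Type) [Fintype W] [DecidableEq W] : Type :=
  Fin n → Set (Fin n) → Matrix.unitaryGroup (Local n b W) ℂ

/-- The tensor product of the unitaries applied by all nodes on input `G`. -/
def tensorMatrix (op : LocalOps n b W) (G : SimpleGraph (Fin n)) :
    Matrix (Config n b W) (Config n b W) ℂ :=
  piMatrix fun v => (op v (G.neighborSet v) : Matrix _ _ ℂ)

/-- The permutation matrix of an exchange of messages. -/
def exchangeMatrix (n b : ℕ) (W : Type) [DecidableEq W] :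
    Matrix (Config n b W) (Config n b W) ℂ :=
  (1 : Matrix (Config n b W) (Config n b W) ℂ).submatrix exchange id

/-- The matrix of a sequence of rounds. -/
def roundsMatrix (G : SimpleGraph (Fin n)) :
    List (LocalOps n b W) → Matrix (Config n b W) (Config n b W) ℂ
  | [] => 1
  | op :: l => roundsMatrix G l * (exchangeMatrix n b W * tensorMatrix op G)

lemma exchangeMatrix_mulVec (φ : Config n b W → ℂ) :
    exchangeMatrix n b W *ᵥ φ = φ ∘ exchange := by
  ext x
  simp [exchangeMatrix, Matrix.mulVec, dotProduct, Matrix.one_apply]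

lemma exchangeMatrix_mulVec_single (x : Config n b W) :
    exchangeMatrix n b W *ᵥ Pi.single x 1 = Pi.single (exchange x) 1 := by
  rw [exchangeMatrix_mulVec]
  ext y
  have : exchange y = x ↔ y = exchange x :=
    ⟨fun h => by rw [← h, exchange_exchange], fun h => by rw [h, exchange_exchange]⟩
  simp [Pi.single_apply, this]

lemma exchangeMatrix_mul_self : exchangeMatrix n b W * exchangeMatrix n b W = 1 := by
  refine Matrix.ext_of_mulVec_single fun x => ?_
  rw [← Matrix.mulVec_mulVec, exchangeMatrix_mulVec_single, exchangeMatrix_mulVec_single,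
    exchange_exchange, Matrix.one_mulVec]

lemma tensorMatrix_one (G : SimpleGraph (Fin n)) :
    tensorMatrix (1 : LocalOps n b W) G = 1 := by
  simpa [tensorMatrix] using piMatrix_one

lemma roundsMatrix_append (G : SimpleGraph (Fin n)) (l l' : List (LocalOps n b W)) :
    roundsMatrix G (l ++ l') = roundsMatrix G l' * roundsMatrix G l := by
  induction l with
  | nil => simp [roundsMatrix]
  | cons op l ih => simp [roundsMatrix, ih, Matrix.mul_assoc]

/-- A family of matrices is implemented by a sequence of at most `r` rounds. -/
def Implements (r : ℕ)
    (U : SimpleGraph (Fin n) → Matrix (Config n b W) (Config n b W) ℂ) : Prop :=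
  ∃ l : List (LocalOps n b W), l.length ≤ r ∧ ∀ G, roundsMatrix G l = U G

lemma Implements.mul {r s : ℕ}
    {U V : SimpleGraph (Fin n) → Matrix (Config n b W) (Config n b W) ℂ}
    (hU : Implements r U) (hV : Implements s V) : Implements (r + s) fun G => V G * U G := by
  obtain ⟨l, hl, hU⟩ := hU
  obtain ⟨l', hl', hV⟩ := hV
  exact ⟨l ++ l', by simp; omega, fun G => by rw [roundsMatrix_append, hU, hV]⟩

lemma implements_one (r : ℕ) :
    Implements r fun _ => (1 : Matrix (Config n b W) (Config n b W) ℂ) :=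
  ⟨[], by simp, fun _ => rfl⟩

lemma implements_exchange : Implements 1 fun _ => exchangeMatrix n b W :=
  ⟨[1], by simp, fun G => by simp [roundsMatrix, tensorMatrix_one]⟩

/-- Every round ends with an exchange. A second round without local action repeats the exchange and
so cancels it, which is why a purely local step is charged two rounds. -/
lemma implements_tensor (op : LocalOps n b W) : Implements 2 (tensorMatrix op) :=
  ⟨[op, 1], by simp, fun G => by
    simp [roundsMatrix, tensorMatrix_one, ← Matrix.mul_assoc, exchangeMatrix_mul_self]⟩

/-- The protocol that performs a given sequence of rounds. -/
def protocolOfRounds (l : List (LocalOps n b W)) (w : W)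
    (out : Fin n → Local n b W → Bool) : Protocol n b where
  Work := W
  init := w
  rounds := l.length
  op v N t := l.getD t 1 v N
  out v _ x := out v x

lemma protocolOfRounds_state (l : List (LocalOps n b W)) (w : W)
    (out : Fin n → Local n b W → Bool) (G : SimpleGraph (Fin n)) (t : ℕ) (ht : t ≤ l.length) :
    (protocolOfRounds l w out).state G t =
      roundsMatrix G (l.take t) *ᵥ Pi.single (fun _ => (w, fun _ _ => false)) 1 := by
  induction t with
  | zero =>
    rw [List.take_zero, roundsMatrix, Matrix.one_mulVec]
    rfl
  | succ t ih =>
    have hstep : (protocolOfRounds l w out).localStep G t = tensorMatrix (l.getD t 1) G := rfl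
    have htake : l.take (t + 1) = l.take t ++ [l.getD t 1] := by
      rw [List.take_add_one]
      simp [List.getElem?_eq_getElem (show t < l.length by omega)]
    have key (op : LocalOps n b W) (φ : Config n b W → ℂ) :
        (fun x => (tensorMatrix op G *ᵥ φ) (exchange x)) = roundsMatrix G [op] *ᵥ φ := by
      rw [roundsMatrix, roundsMatrix, one_mul, ← Matrix.mulVec_mulVec, exchangeMatrix_mulVec]
      rfl
    rw [htake, roundsMatrix_append, ← Matrix.mulVec_mulVec, ← ih (by omega)]
    exact key _ _

lemma protocolOfRounds_finalState (l : List (LocalOps n b W)) (w : W)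
    (out : Fin n → Local n b W → Bool) (G : SimpleGraph (Fin n)) :
    (protocolOfRounds l w out).finalState G =
      roundsMatrix G l *ᵥ Pi.single (fun _ => (w, fun _ _ => false)) 1 := by
  have key (φ : Config n b W → ℂ) : tensorMatrix (l.getD l.length 1) G *ᵥ φ = φ := by
    -- Beyond the end of the list `getD` returns `1`, so the unitary before the final measurement is
    -- trivial.
    rw [List.getD_eq_default _ _ le_rfl, tensorMatrix_one, Matrix.one_mulVec]
  have h := protocolOfRounds_state l w out G l.length le_rfl
  rw [List.take_length] at h
  exact (key _).trans h

/-- Within `r` rounds, the basis states `x G i` can be transformed to the basis states `y G i`,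
and back. -/
def Transports {ι : Type*} (r : ℕ) (x y : SimpleGraph (Fin n) → ι → Config n b W) : Prop :=
  ∃ U V : SimpleGraph (Fin n) → Matrix (Config n b W) (Config n b W) ℂ,
    Implements r U ∧ Implements r V ∧
    (∀ G i, U G *ᵥ Pi.single (x G i) 1 = Pi.single (y G i) 1) ∧
    ∀ G i, V G *ᵥ Pi.single (y G i) 1 = Pi.single (x G i) 1

variable {ι : Type*}

lemma Transports.refl (x : SimpleGraph (Fin n) → ι → Config n b W) : Transports 0 x x :=
  ⟨_, _, implements_one 0, implements_one 0,
    fun _ _ => Matrix.one_mulVec _, fun _ _ => Matrix.one_mulVec _⟩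

lemma Transports.trans {r s : ℕ} {x y z : SimpleGraph (Fin n) → ι → Config n b W}
    (h : Transports r x y) (h' : Transports s y z) : Transports (r + s) x z := by
  obtain ⟨U, V, hU, hV, hxy, hyx⟩ := h
  obtain ⟨U', V', hU', hV', hyz, hzy⟩ := h'
  refine ⟨_, _, hU.mul hU', add_comm s r ▸ hV'.mul hV, fun G i => ?_, fun G i => ?_⟩
  · rw [← Matrix.mulVec_mulVec, hxy, hyz]
  · rw [← Matrix.mulVec_mulVec, hzy, hyx]

lemma transports_exchange (x : SimpleGraph (Fin n) → ι → Config n b W) :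
    Transports 1 x fun G i => exchange (x G i) :=
  ⟨_, _, implements_exchange, implements_exchange,
    fun _ _ => exchangeMatrix_mulVec_single _, fun _ _ => exchangeMatrix_mulVec_single _⟩

lemma tensorMatrix_permUnitary_mulVec (σ : Fin n → Set (Fin n) → Equiv.Perm (Local n b W))
    (G : SimpleGraph (Fin n)) (x : Config n b W) :
    tensorMatrix (fun v N => permUnitary (σ v N)) G *ᵥ Pi.single x 1 =
      Pi.single (fun v => σ v (G.neighborSet v) (x v)) 1 := by
  rw [tensorMatrix, piMatrix_mulVec_single, single_eq_prod]
  simp [permUnitary, Pi.single_apply]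

lemma transports_perm (σ : Fin n → Set (Fin n) → Equiv.Perm (Local n b W))
    (x : SimpleGraph (Fin n) → ι → Config n b W) :
    Transports 2 x fun G i v => σ v (G.neighborSet v) (x G i v) := by
  refine ⟨_, _, implements_tensor fun v N => permUnitary (σ v N),
    implements_tensor fun v N => permUnitary (σ v N)⁻¹, fun G i => ?_, fun G i => ?_⟩
  · rw [tensorMatrix_permUnitary_mulVec]
  · rw [tensorMatrix_permUnitary_mulVec (fun v N => (σ v N)⁻¹)]
    simp

end Network

/-! ### The action of a single node on basis states -/

section Update

variable {ι K : Type*} [Fintype ι] [DecidableEq ι] [Fintype K] [DecidableEq K]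

lemma piMatrix_update_mulVec_single (i : ι) (A : Matrix K K ℂ) (x : ι → K) :
    piMatrix (Function.update 1 i A) *ᵥ Pi.single x 1 =
      ∑ y, A y (x i) • (Pi.single (Function.update x i y) 1 : (ι → K) → ℂ) := by
  rw [piMatrix_mulVec_single]
  ext z
  simp only [Finset.sum_apply, Pi.smul_apply, smul_eq_mul, Pi.single_apply]
  rw [Fintype.prod_eq_mul_prod_compl i, Function.update_self,
    Finset.sum_eq_single (z i) _ (by simp)]
  · congr 1
    split_ifs with h
    · refine Finset.prod_eq_one fun v hv => ?_
      have hv : v ≠ i := by simpa using hv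
      rw [Function.update_of_ne hv, h, Function.update_of_ne hv]
      simp
    · obtain ⟨v, hv⟩ := Function.ne_iff.mp h
      have hvi : v ≠ i := by
        rintro rfl
        simp at hv
      rw [Function.update_of_ne hvi] at hv
      refine Finset.prod_eq_zero (i := v) (by simpa using hvi) ?_
      rw [Function.update_of_ne hvi]
      exact Matrix.one_apply_ne hv
  · intro y _ hy
    rw [if_neg, mul_zero]
    rintro rfl
    simp at hy

lemma sum_controlledLocal {C D V : Type*} [Fintype C] [DecidableEq C] [Fintype D] [DecidableEq D]
    [AddCommGroup V] [Module ℂ V]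
    (U : C → Matrix.unitaryGroup K ℂ) (k : K) (c : C) (d : D) (F : (K × C) × D → V) :
    ∑ y, (controlledLocal (D := D) U : Matrix ((K × C) × D) ((K × C) × D) ℂ) y ((k, c), d) • F y =
      ∑ k', (U c : Matrix K K ℂ) k' k • F ((k', c), d) := by
  simp [controlledLocal, controlled, Fintype.sum_prod_type, Matrix.blockDiagonal_apply, ite_smul]

end Update

/-! ### Reversible simulation of classical programs and queries by the leader -/

/-- The contents of the classical memory of a node: in each slot it stores one message from
every node. -/
abbrev Memory (n b : ℕ) (S : Type) : Type := S → Fin n → Message b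

/-- A classical program that fills every slot of the memories of all nodes with the messages of
one round. The messages for a slot depend on the slots of smaller rank. The node `leader` knows
moreover an element of `J`, in whose place the other nodes use `j₀`. -/
structure Program (n b : ℕ) (S J : Type) (leader : Fin n) (j₀ : J) where
  /-- The slots are filled in the order of their ranks. -/
  rank : S → ℕ
  /-- The contents of the memories at the end. -/
  mem : SimpleGraph (Fin n) → J → Fin n → Memory n b S
  /-- The messages that a node sends. -/
  send : S → Fin n → Set (Fin n) → J → Memory n b S → Fin n → Message b
  send_eq : ∀ s G j u v (M : Memory n b S), (∀ s', rank s' < rank s → M s' = mem G j u s') →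
    send s u (G.neighborSet u) (if u = leader then j else j₀) M v = mem G j v s u

section Classical

set_option synthInstance.maxSize 1000
set_option linter.unusedSectionVars false

variable {n b : ℕ} {Q S J : Type} [Fintype Q] [DecidableEq Q] [Fintype S] [DecidableEq S]

/-- The permutation that writes messages to clean message registers. -/
def writePerm (g : Q × Memory n b S → Fin n → Message b) :
    Equiv.Perm (Local n b (Q × Memory n b S)) :=
  Equiv.prodShear (Equiv.refl _) fun w => Equiv.swap (fun _ _ => false) (g w)

/-- The permutation that swaps the message registers with a slot of the memory. -/
def storePerm (Q : Type) (s : S) : Equiv.Perm (Local n b (Q × Memory n b S)) :=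
  Function.Involutive.toPerm (fun x => ((x.1.1, Function.update x.1.2 s x.2), x.1.2 s))
    fun x => by simp

open Classical in
/-- The configuration with contents `M` in the slots in `A` and clean registers elsewhere. -/
def memConfig (A : Set S) (q : Fin n → Q) (M : Fin n → Memory n b S) :
    Config n b (Q × Memory n b S) :=
  fun v => ((q v, fun s => if s ∈ A then M v s else fun _ _ => false), fun _ _ => false)

/-- The messages are written to clean registers (2 rounds), exchanged (1 round), and swapped with
the slot `s` (2 rounds). As the slot was clean, the message registers are clean again afterwards. -/
lemma transports_insert {ι : Type*} (q : ι → Fin n → Q)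
    (M : SimpleGraph (Fin n) → ι → Fin n → Memory n b S) (A : Set S) (s : S) (hs : s ∉ A)
    (g : Fin n → Set (Fin n) → Q × Memory n b S → Fin n → Message b)
    (hg : ∀ G i u v, g u (G.neighborSet u) (memConfig A (q i) (M G i) u).1 v = M G i v s u) :
    Transports 5 (fun G i => memConfig A (q i) (M G i))
      (fun G i => memConfig (insert s A) (q i) (M G i)) := by
  have h1 := transports_perm (fun v N => writePerm (g v N))
    (fun G i => memConfig A (q i) (M G i))
  have h2 := h1.trans (transports_exchange _)
  have h3 := h2.trans (transports_perm (fun _ _ => storePerm Q s) _)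
  convert h3 using 3 with G i
  funext v
  have hv : (fun u => g u (G.neighborSet u) (memConfig A (q i) (M G i) u).1 v) = M G i v s :=
    funext fun u => hg G i u v
  simp only [writePerm, storePerm, exchange, memConfig, Equiv.prodShear_apply,
    Equiv.swap_apply_left, Equiv.refl_apply] at hv ⊢
  classical
  rw [hv]
  -- The message registers now hold the former content of slot `s`, which is clean because `s ∉ A`.
  change _ = ((_, Function.update _ s _), (fun s => if s ∈ A then M G i v s else fun _ _ => false) s)
  simp only [hs, if_false]
  refine Prod.ext (Prod.ext rfl (funext fun s' => ?_)) rfl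
  by_cases h : s' = s
  · subst h; simp
  · simp [h]

/-- The messages for slots in `B` depend only on the slots in `A`, so the slots of `B` can be filled
one after the other in any order. -/
lemma transports_union {ι : Type*} (q : ι → Fin n → Q)
    (M : SimpleGraph (Fin n) → ι → Fin n → Memory n b S) (A : Set S)
    (g : S → Fin n → Set (Fin n) → Q × Memory n b S → Fin n → Message b) (B : Finset S)
    (hB : ∀ s ∈ B, s ∉ A)
    (hg : ∀ s ∈ B, ∀ G i u v (M' : Memory n b S), (∀ s' ∈ A, M' s' = M G i u s') →
      g s u (G.neighborSet u) (q i u, M') v = M G i v s u) :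
    Transports (5 * B.card) (fun G i => memConfig A (q i) (M G i))
      (fun G i => memConfig (A ∪ B) (q i) (M G i)) := by
  induction B using Finset.induction_on with
  | empty => simpa using Transports.refl _
  | insert s B hs ih =>
    rw [Finset.card_insert_of_notMem hs, mul_add, Finset.coe_insert, Set.union_insert]
    refine (ih (fun s' h => hB s' (Finset.mem_insert_of_mem h))
      fun s' h => hg s' (Finset.mem_insert_of_mem h)).trans ?_
    refine transports_insert q M _ s ?_ (g s) fun G i u v => ?_
    · simp [hs, hB s (Finset.mem_insert_self s B)]
    · refine hg s (Finset.mem_insert_self s B) G i u v _ fun s' hs' => ?_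
      simp [hs']

namespace Program

variable {leader : Fin n} {j₀ : J} (P : Program n b S J leader j₀)

/-- The configuration in which the leader has the content `q` in its register of type `Q`, and
the slots of rank less than `k` are filled. -/
def config (sel : Q → J) (q₀ : Q) (k : ℕ) (G : SimpleGraph (Fin n)) (q : Q) :
    Config n b (Q × Memory n b S) :=
  memConfig {s | P.rank s < k} (fun v => if v = leader then q else q₀) (P.mem G (sel q))

/-- The number of slots whose rank is in `[a, c)`. -/
def slotCount (a c : ℕ) : ℕ := (Finset.univ.filter fun s => a ≤ P.rank s ∧ P.rank s < c).card

lemma slotCount_succ {a c : ℕ} (h : a ≤ c) :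
    P.slotCount a (c + 1) = P.slotCount a c + P.slotCount c (c + 1) := by
  classical
  unfold slotCount
  rw [← Finset.card_union_of_disjoint]
  · congr 1
    ext s
    simp only [Finset.mem_filter_univ, Finset.mem_union]
    omega
  · rw [Finset.disjoint_left]
    intro s
    simp only [Finset.mem_filter_univ]
    omega

/-- Induction on the rank: the messages for the slots of rank `c` are determined by the slots of
smaller rank, which are already filled. -/
lemma transports_config (sel : Q → J) (q₀ : Q) (hq₀ : sel q₀ = j₀) {a c : ℕ} (h : a ≤ c) :
    Transports (5 * P.slotCount a c) (P.config sel q₀ a) (P.config sel q₀ c) := by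
  induction c, h using Nat.le_induction with
  | base => simpa [slotCount, show ∀ x, ¬ (a ≤ x ∧ x < a) by omega] using Transports.refl _
  | succ c h ih =>
    rw [slotCount_succ P h, mul_add]
    refine ih.trans ?_
    have := transports_union (fun q v => if v = leader then q else q₀)
      (fun G q => P.mem G (sel q)) {s | P.rank s < c}
      (fun s u N w => P.send s u N (sel w.1) w.2)
      (Finset.univ.filter fun s => c ≤ P.rank s ∧ P.rank s < c + 1)
      (fun s hs => by simp at hs ⊢; omega) (fun s hs G q u v M hM => by
        have hs : P.rank s = c := by simp at hs; omega
        rw [← P.send_eq s G (sel q) u v M fun s' h => hM s' (by simpa [hs] using h)]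
        congr 1
        split_ifs <;> simp [hq₀])
    have hset : {s | P.rank s < c} ∪
        ((Finset.univ.filter fun s => c ≤ P.rank s ∧ P.rank s < c + 1 : Finset S) : Set S) =
        {s | P.rank s < c + 1} := by
      ext s
      simp
      omega
    rwa [hset] at this

lemma config_injective (sel : Q → J) (q₀ : Q) (k : ℕ) (G : SimpleGraph (Fin n)) :
    Function.Injective (P.config sel q₀ k G) := by
  intro q q' h
  have := congrArg (fun x => (x leader).1.1) h
  simpa [config, memConfig] using this

/-- The state of the network in which the leader has the state `ψ` in its register, and the slots
of rank less than `k` are filled. -/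
def embed (sel : Q → J) (q₀ : Q) (k : ℕ) (G : SimpleGraph (Fin n)) (ψ : Q → ℂ) :
    Config n b (Q × Memory n b S) → ℂ :=
  ∑ q, ψ q • Pi.single (P.config sel q₀ k G q) 1

lemma embed_config (sel : Q → J) (q₀ : Q) (k : ℕ) (G : SimpleGraph (Fin n)) (ψ : Q → ℂ) (q : Q) :
    P.embed sel q₀ k G ψ (P.config sel q₀ k G q) = ψ q := by
  simp [embed, Pi.single_apply, (P.config_injective sel q₀ k G).eq_iff]

lemma embed_eq_zero (sel : Q → J) (q₀ : Q) (k : ℕ) (G : SimpleGraph (Fin n)) (ψ : Q → ℂ)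
    (x : Config n b (Q × Memory n b S)) (hx : ∀ q, x ≠ P.config sel q₀ k G q) :
    P.embed sel q₀ k G ψ x = 0 := by
  simp [embed, hx]

/-- By linearity it is enough to follow the basis states of the leader's register. -/
lemma mulVec_embed (sel : Q → J) (q₀ : Q) (k k' : ℕ) (G : SimpleGraph (Fin n)) (ψ : Q → ℂ)
    (U : Matrix (Config n b (Q × Memory n b S)) (Config n b (Q × Memory n b S)) ℂ)
    (V : Matrix Q Q ℂ)
    (h : ∀ q, U *ᵥ Pi.single (P.config sel q₀ k G q) 1 =
      ∑ q', V q' q • Pi.single (P.config sel q₀ k' G q') 1) :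
    U *ᵥ P.embed sel q₀ k G ψ = P.embed sel q₀ k' G (V *ᵥ ψ) := by
  simp only [embed, Matrix.mulVec_sum, Matrix.mulVec_smul, h]
  simp only [Finset.smul_sum, smul_smul, Matrix.mulVec, dotProduct, Finset.sum_smul]
  rw [Finset.sum_comm]
  simp only [mul_comm]

/-- A unitary that the leader applies to its register, controlled by the contents of the memory. -/
def leaderOp (leader : Fin n) (U : Memory n b S → Matrix.unitaryGroup Q ℂ) :
    LocalOps n b (Q × Memory n b S) :=
  fun v _ => if v = leader then controlledLocal U else 1

lemma leaderOp_mulVec_config (sel : Q → J) (q₀ : Q) (k : ℕ) (G : SimpleGraph (Fin n))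
    (U : Memory n b S → Matrix.unitaryGroup Q ℂ) (q : Q) :
    tensorMatrix (leaderOp leader U) G *ᵥ Pi.single (P.config sel q₀ k G q) 1 =
      ∑ q', (U (P.config sel q₀ k G q leader).1.2 : Matrix Q Q ℂ) q' q •
        Pi.single (Function.update (P.config sel q₀ k G q) leader
          ((q', (P.config sel q₀ k G q leader).1.2), fun _ _ => false)) 1 := by
  have h : (fun v => (leaderOp leader U v (G.neighborSet v) : Matrix _ _ ℂ)) =
      Function.update (1 : Fin n →
          Matrix (Local n b (Q × Memory n b S)) (Local n b (Q × Memory n b S)) ℂ) leader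
        (controlledLocal (D := Fin n → Message b) U).1 := by
    funext v
    by_cases hv : v = leader
    · subst hv; simp [leaderOp]
    · simp [leaderOp, hv]
  rw [tensorMatrix, h, piMatrix_update_mulVec_single]
  have hl : P.config sel q₀ k G q leader =
      ((q, (P.config sel q₀ k G q leader).1.2), fun _ _ => false) := by
    simp [config, memConfig]
  conv_lhs =>
    enter [2, y]
    rw [hl]
  exact sum_controlledLocal U _ _ _ _

/-- Changing the leader's register leads to another legitimate configuration only if the filled
slots have the same contents for both values; otherwise the memory would be entangled with a value
that the register no longer has. -/
lemma update_config (sel : Q → J) (q₀ : Q) (k : ℕ) (G : SimpleGraph (Fin n)) (q q' : Q)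
    (h : ∀ s v, P.rank s < k → P.mem G (sel q) v s = P.mem G (sel q') v s) :
    Function.update (P.config sel q₀ k G q) leader
      ((q', (P.config sel q₀ k G q leader).1.2), fun _ _ => false) = P.config sel q₀ k G q' := by
  funext v
  by_cases hv : v = leader
  · subst hv
    rw [Function.update_self]
    refine Prod.ext (Prod.ext (by simp [config, memConfig]) (funext fun s => ?_)) rfl
    simp only [config, memConfig, Set.mem_ofPred_eq]
    split_ifs with hs
    · exact h s _ hs
    · rfl
  · rw [Function.update_of_ne hv]
    refine Prod.ext (Prod.ext (by simp [config, memConfig, hv]) (funext fun s => ?_)) rfl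
    simp only [config, memConfig, Set.mem_ofPred_eq]
    split_ifs with hs
    · exact h s _ hs
    · rfl

/-- With `r` rounds, the network transforms the register of the leader by `V G`. -/
def Simulates (sel : Q → J) (q₀ : Q) (k r : ℕ) (V : SimpleGraph (Fin n) → Matrix Q Q ℂ) : Prop :=
  ∃ U, Implements r U ∧
    ∀ G ψ, U G *ᵥ P.embed sel q₀ k G ψ = P.embed sel q₀ k G (V G *ᵥ ψ)

variable {P} {sel : Q → J} {q₀ : Q} {k : ℕ}

lemma Simulates.mul {r s : ℕ} {V V' : SimpleGraph (Fin n) → Matrix Q Q ℂ}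
    (h : P.Simulates sel q₀ k r V) (h' : P.Simulates sel q₀ k s V') :
    P.Simulates sel q₀ k (r + s) fun G => V' G * V G := by
  obtain ⟨U, hU, hUV⟩ := h
  obtain ⟨U', hU', hUV'⟩ := h'
  refine ⟨_, hU.mul hU', fun G ψ => ?_⟩
  rw [← Matrix.mulVec_mulVec, hUV, hUV', Matrix.mulVec_mulVec]

lemma simulates_one : P.Simulates sel q₀ k 0 fun _ => 1 :=
  ⟨_, implements_one 0, by simp⟩

lemma Simulates.pow {r : ℕ} {V : SimpleGraph (Fin n) → Matrix Q Q ℂ}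
    (h : P.Simulates sel q₀ k r V) (m : ℕ) :
    P.Simulates sel q₀ k (m * r) fun G => V G ^ m := by
  induction m with
  | zero => simpa using simulates_one
  | succ m ih =>
    rw [add_mul, one_mul, add_comm]
    simpa only [pow_succ] using h.mul ih

lemma simulates_unitary (hk : ∀ G j v s, P.rank s < k → P.mem G j v s = P.mem G j₀ v s)
    (A : Matrix.unitaryGroup Q ℂ) : P.Simulates sel q₀ k 2 fun _ => A := by
  refine ⟨_, implements_tensor (leaderOp leader fun _ => A), fun G ψ => ?_⟩
  refine P.mulVec_embed sel q₀ k k G ψ _ _ fun q => ?_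
  rw [leaderOp_mulVec_config]
  refine Finset.sum_congr rfl fun q' _ => ?_
  rw [update_config _ _ _ _ _ _ _ fun s v hs => ?_]
  rw [hk G (sel q) v s hs, hk G (sel q') v s hs]

/-- The leader computes a bit with the help of the network, applies a unitary that depends on
this bit, and uncomputes the bit. -/
lemma simulates_query (hq₀ : sel q₀ = j₀) {c : ℕ} (hkc : k ≤ c) (hc : ∀ s, P.rank s < c)
    (answer : Memory n b S → Bool) (A : Bool → Matrix.unitaryGroup Q ℂ)
    -- Since `A` preserves the selected element, the memory still fits the register and can be
    -- uncomputed.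
    (hA : ∀ x q q', (A x : Matrix Q Q ℂ) q q' ≠ 0 → sel q = sel q') :
    P.Simulates sel q₀ k (10 * P.slotCount k c + 2) fun G =>
      Matrix.of fun q q' => (A (answer (P.mem G (sel q') leader)) : Matrix Q Q ℂ) q q' := by
  obtain ⟨U, V, hU, hV, hUx, hVx⟩ := P.transports_config sel q₀ hq₀ hkc
  have hmem (G q) : (P.config sel q₀ c G q leader).1.2 = P.mem G (sel q) leader := by
    funext s
    simp [config, memConfig, hc]
  -- Compute, act locally, uncompute.
  have hr : 10 * P.slotCount k c + 2 = 5 * P.slotCount k c + 2 + 5 * P.slotCount k c := by ring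
  rw [hr]
  refine ⟨_, (hU.mul (implements_tensor (leaderOp leader fun M => A (answer M)))).mul hV,
    fun G ψ => ?_⟩
  · rw [← Matrix.mulVec_mulVec, ← Matrix.mulVec_mulVec]
    rw [P.mulVec_embed sel q₀ k c G ψ _ 1 fun q => ?_,
      P.mulVec_embed sel q₀ c c G _ _ (Matrix.of fun q q' =>
        (A (answer (P.mem G (sel q') leader)) : Matrix Q Q ℂ) q q') fun q => ?_,
      P.mulVec_embed sel q₀ c k G _ _ 1 fun q => ?_, Matrix.one_mulVec, Matrix.one_mulVec]
    · rw [hVx]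
      simp [Matrix.one_apply]
    · rw [leaderOp_mulVec_config]
      refine Finset.sum_congr rfl fun q' _ => ?_
      rw [hmem, Matrix.of_apply]
      by_cases h : (A (answer (P.mem G (sel q) leader)) : Matrix Q Q ℂ) q' q = 0
      · simp [h]
      · rw [← hmem, update_config _ _ _ _ _ _ _ fun s v _ => by rw [hA _ _ _ h]]
    · rw [hUx]
      simp [Matrix.one_apply]

end Program

end Classical

/-! ### Reflections as unitaries -/

section Reflection

variable {K : Type*} [Fintype K] [DecidableEq K]

/-- The reflection in the hyperplane orthogonal to a real vector. -/
def reflection (w : K → ℝ) : Matrix.unitaryGroup K ℂ :=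
  ⟨1 - (2 / ∑ k, (w k : ℂ) ^ 2) •
      Matrix.vecMulVec (fun k => (w k : ℂ)) (fun k => (w k : ℂ)), by
    set c : ℂ := 2 / ∑ k, (w k : ℂ) ^ 2 with hc
    set p := Matrix.vecMulVec (fun k => (w k : ℂ)) (fun k => (w k : ℂ)) with hp
    have hstar : star (1 - c • p) = 1 - c • p := by
      have hcc : star c = c := by
        simp [hc]
      have hpp : pᴴ = p := by
        ext i j
        simp [hp, Matrix.vecMulVec_apply, mul_comm]
      rw [Matrix.star_eq_conjTranspose, Matrix.conjTranspose_sub, Matrix.conjTranspose_smul, hcc,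
        hpp, Matrix.conjTranspose_one]
    have hmul : p * p = (∑ k, (w k : ℂ) ^ 2) • p := by
      ext i j
      simp only [hp, Matrix.mul_apply, Matrix.vecMulVec_apply, Matrix.smul_apply, smul_eq_mul,
        Finset.sum_mul]
      exact Finset.sum_congr rfl fun k _ => by ring
    rw [Matrix.mem_unitaryGroup_iff, hstar]
    have hcs : c * c * ∑ k, (w k : ℂ) ^ 2 = 2 * c := by
      -- For `w = 0` division by zero makes the coefficient `0`, and the reflection is the identity.
      by_cases h : ∑ k, (w k : ℂ) ^ 2 = 0
      · simp [hc, h]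
      · rw [hc]; field_simp
    rw [mul_sub, mul_one, sub_mul, one_mul, smul_mul_smul_comm, hmul, smul_smul, hcs, two_mul,
      add_smul]
    abel⟩

lemma reflection_mulVec (w : K → ℝ) (ψ : K → ℂ) :
    (reflection w : Matrix K K ℂ) *ᵥ ψ =
      fun k => ψ k - (2 / ∑ k, (w k : ℂ) ^ 2) * (∑ k, (w k : ℂ) * ψ k) * w k := by
  ext k
  simp only [reflection, Matrix.sub_mulVec, Matrix.one_mulVec, Matrix.smul_mulVec,
    Pi.sub_apply, Pi.smul_apply, smul_eq_mul, Matrix.vecMulVec_mulVec, dotProduct]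
  simp
  ring

end Reflection

/-! ### Grover search on the leader's register -/

section Grover

variable {J : Type} [Fintype J] [DecidableEq J]

/-- The amplitudes `a` on marked and `b` on unmarked elements, all with flag `false`. -/
def groverState (f : J → Bool) (a b : ℝ) (k : J × Bool) : ℂ :=
  ((if k.2 then 0 else if f k.1 then a else b : ℝ) : ℂ)

/-- The unitary that prepares the uniform superposition from a basis state. -/
def groverInit (j₀ : J) : Matrix.unitaryGroup (J × Bool) ℂ :=
  reflection fun k => (if k = (j₀, false) then √(Fintype.card J) else 0) - if k.2 then 0 else 1

/-- The inversion about the mean. -/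
def groverDiffusion (J : Type) [Fintype J] [DecidableEq J] : Matrix.unitaryGroup (J × Bool) ℂ :=
  -reflection fun k => if k.2 then 0 else 1

/-- The phase `-1` on marked elements. -/
def groverPhase (J : Type) [Fintype J] [DecidableEq J] (x : Bool) :
    Matrix.unitaryGroup (J × Bool) ℂ :=
  if x then -1 else 1

/-- The unitary that flips the flag on marked elements. -/
def groverFlip (J : Type) [Fintype J] [DecidableEq J] (x : Bool) :
    Matrix.unitaryGroup (J × Bool) ℂ :=
  if x then permUnitary ((Equiv.refl J).prodCongr Equiv.boolNot) else 1

/-- The application to a basis state of a unitary that depends on whether it is marked. -/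
def queryMatrix (f : J → Bool) (A : Bool → Matrix.unitaryGroup (J × Bool) ℂ) :
    Matrix (J × Bool) (J × Bool) ℂ :=
  Matrix.of fun k k' => (A (f k'.1) : Matrix (J × Bool) (J × Bool) ℂ) k k'

/-- Grover search with `m` iterations; at the end the flag tells whether the element is marked. -/
def groverRun (f : J → Bool) (j₀ : J) (m : ℕ) : Matrix (J × Bool) (J × Bool) ℂ :=
  queryMatrix f (groverFlip J) *
    (((groverDiffusion J : Matrix (J × Bool) (J × Bool) ℂ) * queryMatrix f (groverPhase J)) ^ m *
      (groverInit j₀ : Matrix (J × Bool) (J × Bool) ℂ))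

/-- The angle by which a Grover iteration rotates is twice this angle. -/
def groverAngle (f : J → Bool) : ℝ :=
  Real.arcsin √((Finset.univ.filter fun j => f j = true).card / Fintype.card J)

lemma coe_groverPhase (x : Bool) :
    (groverPhase J x : Matrix (J × Bool) (J × Bool) ℂ) = if x then -1 else 1 := by
  cases x <;> rfl

lemma groverPhase_apply_ne {x : Bool} {k k' : J × Bool}
    (h : (groverPhase J x : Matrix (J × Bool) (J × Bool) ℂ) k k' ≠ 0) : k.1 = k'.1 := by
  by_contra hk
  have : k ≠ k' := fun h => hk (by rw [h])
  cases x <;> simp [coe_groverPhase, this] at h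

lemma groverFlip_apply_ne {x : Bool} {k k' : J × Bool}
    (h : (groverFlip J x : Matrix (J × Bool) (J × Bool) ℂ) k k' ≠ 0) : k.1 = k'.1 := by
  by_contra hk
  have : k ≠ k' := fun h => hk (by rw [h])
  cases x
  · simp [groverFlip, this] at h
  · simp [groverFlip, permUnitary] at h
    exact hk (by rw [h]; rfl)

/-- The vectors `√N • e` and `(1, …, 1)` (on flag `false`) have the same norm, so the reflection
along their difference swaps them; dividing by `√N` gives the claim. For `N = 1` the difference
vanishes and the reflection is the identity, as required. -/
lemma groverInit_mulVec (f : J → Bool) (j₀ : J) :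
    (groverInit j₀ : Matrix (J × Bool) (J × Bool) ℂ) *ᵥ Pi.single (j₀, false) 1 =
      groverState f (1 / √(Fintype.card J)) (1 / √(Fintype.card J)) := by
  set N : ℝ := ((Fintype.card J : ℕ) : ℝ) with hN
  have hN1 : 1 ≤ N := by
    have : 0 < Fintype.card J := Fintype.card_pos_iff.mpr ⟨j₀⟩
    rw [hN]; exact_mod_cast this
  have hs : √N * √N = N := Real.mul_self_sqrt (by linarith)
  have hs1 : 1 ≤ √N := Real.one_le_sqrt.mpr hN1
  have hsC : (√N : ℂ) * √N = N := by exact_mod_cast hs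
  have hsum : ∑ k : J × Bool, (((if k = (j₀, false) then √N else 0) -
      if k.2 then 0 else 1 : ℝ) : ℂ) ^ 2 = ((2 * N - 2 * √N : ℝ) : ℂ) := by
    have h1 (k : J × Bool) : (((if k = (j₀, false) then √N else 0) -
        if k.2 then 0 else 1 : ℝ) : ℂ) ^ 2 =
        (if k = (j₀, false) then (N - 2 * √N : ℂ) else 0) + if k.2 then 0 else 1 := by
      obtain ⟨j, x⟩ := k
      cases x <;> by_cases h : j = j₀ <;> simp [h]
      rw [← hsC]; ring
    simp only [h1, Finset.sum_add_distrib, Finset.sum_ite_eq', Finset.mem_univ, if_true]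
    simp only [Fintype.sum_prod_type, Fintype.sum_bool]
    simp [hN]
    ring
  rw [groverInit, reflection_mulVec, ← hN, hsum]
  have hdot : ∑ k : J × Bool, (((if k = (j₀, false) then √N else 0) -
      if k.2 then 0 else 1 : ℝ) : ℂ) * (Pi.single (j₀, false) 1 : J × Bool → ℂ) k =
      ((√N - 1 : ℝ) : ℂ) := by
    simp [Pi.single_apply]
  rw [hdot]
  ext ⟨j, x⟩
  -- The squared norm is `2√N(√N - 1)` and the inner product is `√N - 1`; the quotient degenerates
  -- exactly at `√N = 1`.
  have hfac : (2 / ((2 * N - 2 * √N : ℝ) : ℂ) * ((√N - 1 : ℝ) : ℂ)) = ((if √N = 1 then 0 else 1 / √N : ℝ) : ℂ) := by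
    split_ifs with h
    · simp [h]
    · rw [← Complex.ofReal_ofNat, ← Complex.ofReal_div, ← Complex.ofReal_mul]
      congr 1
      have h0 : √N - 1 ≠ 0 := sub_ne_zero.mpr h
      have : 2 * N - 2 * √N = 2 * √N * (√N - 1) := by nlinarith
      rw [this]
      have : √N ≠ 0 := by positivity
      field_simp
  rw [hfac]
  have hs0 : √N ≠ 0 := by positivity
  have hj (h1 : √N = 1) (h : j ≠ j₀) : False := by
    have : N = 1 := by rw [← hs, h1, one_mul]
    rw [hN] at this
    have : Fintype.card J = 1 := by exact_mod_cast this
    exact h (Fintype.card_le_one_iff.mp this.le j j₀)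
  cases x
  · by_cases h : j = j₀
    · subst h
      by_cases h1 : √N = 1
      · simp [groverState, h1]
      · simp only [groverState, if_neg h1]
        simp
        have : (√N : ℂ) ≠ 0 := by exact_mod_cast hs0
        field_simp
        ring
    · have h1 : √N ≠ 1 := fun h1 => hj h1 h
      simp [groverState, h, h1]
  · simp [groverState]

lemma queryMatrix_groverPhase_mulVec (f : J → Bool) (a b : ℝ) :
    queryMatrix f (groverPhase J) *ᵥ groverState f a b = groverState f (-a) b := by
  have h : queryMatrix f (groverPhase J) =
      Matrix.diagonal fun k : J × Bool => if f k.1 then (-1 : ℂ) else 1 := by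
    ext k k'
    rw [queryMatrix, Matrix.of_apply, Matrix.diagonal_apply]
    by_cases hk : k = k'
    · subst hk
      cases h : f k.1 <;> simp [coe_groverPhase]
    · cases h : f k'.1 <;> simp [coe_groverPhase, hk]
  ext ⟨j, x⟩
  rw [h, Matrix.mulVec_diagonal]
  cases x <;> cases h : f j <;> simp [groverState, h]

omit [DecidableEq J] in
lemma sum_groverState (f : J → Bool) (a b : ℝ) :
    ∑ j, groverState f a b (j, false) =
      (((Finset.univ.filter fun j => f j = true).card * a +
        (Fintype.card J - (Finset.univ.filter fun j => f j = true).card) * b : ℝ) : ℂ) := by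
  have hcard := Finset.card_filter_add_card_filter_not (s := (Finset.univ : Finset J))
    (fun j => f j = true)
  rw [Finset.card_univ] at hcard
  simp only [groverState, ← Complex.ofReal_sum, Bool.false_eq_true, if_false]
  rw [Finset.sum_ite, Finset.sum_const, Finset.sum_const, ← hcard]
  push_cast
  simp

lemma groverDiffusion_mulVec (f : J → Bool) (a b μ : ℝ)
    (hμ : μ = ((Finset.univ.filter fun j => f j = true).card * a +
      (Fintype.card J - (Finset.univ.filter fun j => f j = true).card) * b) / Fintype.card J) :
    (groverDiffusion J : Matrix (J × Bool) (J × Bool) ℂ) *ᵥ groverState f a b =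
      groverState f (2 * μ - a) (2 * μ - b) := by
  have hc : ((groverDiffusion J : Matrix.unitaryGroup (J × Bool) ℂ) :
      Matrix (J × Bool) (J × Bool) ℂ) =
      -(reflection fun k : J × Bool => if k.2 then (0 : ℝ) else 1).1 := rfl
  rw [hc, Matrix.neg_mulVec, reflection_mulVec]
  have h1 : ∑ k : J × Bool, (((if k.2 then (0 : ℝ) else 1 : ℝ)) : ℂ) ^ 2 = Fintype.card J := by
    simp [Fintype.sum_prod_type]
  have h2 : ∑ k : J × Bool, (((if k.2 then (0 : ℝ) else 1 : ℝ)) : ℂ) * groverState f a b k =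
      ∑ j, groverState f a b (j, false) := by
    simp [Fintype.sum_prod_type]
  rw [h1, h2, sum_groverState]
  have h3 : (2 / (Fintype.card J : ℂ)) *
      (((Finset.univ.filter fun j => f j = true).card * a +
        (Fintype.card J - (Finset.univ.filter fun j => f j = true).card) * b : ℝ) : ℂ) =
      ((2 * μ : ℝ) : ℂ) := by
    rw [hμ]
    push_cast
    ring
  rw [h3]
  ext ⟨j, x⟩
  cases x <;> cases h : f j <;> simp [groverState, h]

lemma queryMatrix_groverFlip_mulVec (f : J → Bool) (a b : ℝ) (j : J) (x : Bool) :
    (queryMatrix f (groverFlip J) *ᵥ groverState f a b) (j, x) =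
      if f j = x then groverState f a b (j, false) else 0 := by
  have h (j : J) (x : Bool) (k : J × Bool) : queryMatrix f (groverFlip J) (j, x) k =
      if k = (j, xor x (f j)) then 1 else 0 := by
    obtain ⟨j', y⟩ := k
    rw [queryMatrix, Matrix.of_apply]
    by_cases hj : j' = j
    · subst hj
      cases hf : f j' <;> cases x <;> cases y <;> simp [groverFlip, permUnitary]
    · have hj' : j ≠ j' := fun h => hj h.symm
      cases hf : f j' <;> simp [groverFlip, permUnitary, hj, hj']
  simp only [Matrix.mulVec, dotProduct, h, ite_mul, one_mul, zero_mul, Finset.sum_ite_eq',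
    Finset.mem_univ, if_true]
  cases hf : f j <;> cases x <;> simp [groverState, hf]

/-- The state stays in the plane spanned by the marked and the unmarked uniform vectors, and each
iteration rotates it there by `2 * groverAngle f`. Coordinates are multiplied by the norms of these
vectors instead of divided, so the cases of no or only marked elements need no separate treatment.
-/
lemma groverIteration_mulVec (f : J → Bool) (j₀ : J) (m : ℕ) :
    ∃ a b : ℝ,
      ((groverDiffusion J : Matrix (J × Bool) (J × Bool) ℂ) * queryMatrix f (groverPhase J)) ^ m *ᵥ
        ((groverInit j₀ : Matrix (J × Bool) (J × Bool) ℂ) *ᵥ Pi.single (j₀, false) 1) =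
          groverState f a b ∧
      √(Finset.univ.filter fun j => f j = true).card * a = Real.sin ((2 * m + 1) * groverAngle f) ∧
      √(Fintype.card J - (Finset.univ.filter fun j => f j = true).card) * b =
        Real.cos ((2 * m + 1) * groverAngle f) := by
  set N : ℝ := ((Fintype.card J : ℕ) : ℝ) with hN
  set t : ℝ := (((Finset.univ.filter fun j => f j = true).card : ℕ) : ℝ) with ht
  have hN0 : 0 < N := by
    have : 0 < Fintype.card J := Fintype.card_pos_iff.mpr ⟨j₀⟩
    rw [hN]; exact_mod_cast this
  have ht0 : 0 ≤ t := Nat.cast_nonneg _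
  have htN : t ≤ N := by
    rw [ht, hN]; exact_mod_cast Finset.card_le_univ _
  have hst : √t * √t = t := Real.mul_self_sqrt ht0
  have hsr : √(N - t) * √(N - t) = N - t := Real.mul_self_sqrt (by linarith)
  have hsN : √N * √N = N := Real.mul_self_sqrt hN0.le
  have hsN0 : 0 < √N := Real.sqrt_pos.mpr hN0
  have hsin : Real.sin (groverAngle f) = √t / √N := by
    rw [groverAngle, Real.sin_arcsin, Real.sqrt_div ht0]
    · linarith [Real.sqrt_nonneg (t / N)]
    · exact Real.sqrt_le_one.mpr ((div_le_one hN0).mpr htN)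
  have hcos : Real.cos (groverAngle f) = √(N - t) / √N := by
    rw [groverAngle, Real.cos_arcsin, Real.sq_sqrt (div_nonneg ht0 hN0.le),
      ← Real.sqrt_div (by linarith)]
    congr 1
    change 1 - t / N = (N - t) / N
    field_simp
  have hinit : (groverInit j₀ : Matrix (J × Bool) (J × Bool) ℂ) *ᵥ Pi.single (j₀, false) 1 =
      groverState f (1 / √N) (1 / √N) := groverInit_mulVec f j₀
  -- From here on only the relations between the three square roots matter, and the induction step
  -- is polynomial algebra with the addition formulas.
  generalize √t = s at *
  generalize √(N - t) = r at *
  generalize √N = q at *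
  induction m with
  | zero =>
    refine ⟨1 / q, 1 / q, ?_, ?_, ?_⟩
    · rw [pow_zero, Matrix.one_mulVec, hinit]
    · simp [hsin, div_eq_mul_inv]
    · simp [hcos, div_eq_mul_inv]
  | succ m ih =>
    obtain ⟨a, b, hψ, ha, hb⟩ := ih
    set φ := (2 * (m : ℝ) + 1) * groverAngle f with hφ
    have hadd : (2 * ((m + 1 : ℕ) : ℝ) + 1) * groverAngle f = φ + 2 * groverAngle f := by
      rw [hφ]; push_cast; ring
    have hq0 := hsN0.ne'
    refine ⟨2 * ((t * -a + (N - t) * b) / N) - -a, 2 * ((t * -a + (N - t) * b) / N) - b, ?_, ?_, ?_⟩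
    · rw [pow_succ', ← Matrix.mulVec_mulVec, hψ, ← Matrix.mulVec_mulVec,
        queryMatrix_groverPhase_mulVec, groverDiffusion_mulVec f _ _ _ rfl]
    · have h1 : s * (2 * ((t * -a + (N - t) * b) / N) - -a) =
          s * a + 2 * s * (-s * (s * a) + r * (r * b)) / N := by
        rw [← hsr, ← hst]
        ring
      rw [h1, ha, hb, hadd, Real.sin_add, Real.sin_two_mul, Real.cos_two_mul, hsin, hcos, ← hsN]
      have h2 : r ^ 2 = q ^ 2 - s ^ 2 := by nlinarith
      field_simp
      rw [h2]
      ring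
    · have h1 : r * (2 * ((t * -a + (N - t) * b) / N) - b) =
          2 * r * (-s * (s * a) + r * (r * b)) / N - r * b := by
        rw [← hsr, ← hst]
        ring
      rw [h1, ha, hb, hadd, Real.cos_add, Real.sin_two_mul, Real.cos_two_mul, hsin, hcos, ← hsN]
      field_simp
      ring

/-- The probability that Grover search fails to find a marked element. -/
lemma sum_groverRun (f : J → Bool) (j₀ : J) (m : ℕ) :
    (∑ j, ‖(groverRun f j₀ m *ᵥ Pi.single (j₀, false) 1) (j, false)‖ ^ 2 =
      Real.cos ((2 * m + 1) * groverAngle f) ^ 2) ∧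
    ∑ j, ‖(groverRun f j₀ m *ᵥ Pi.single (j₀, false) 1) (j, true)‖ ^ 2 =
      Real.sin ((2 * m + 1) * groverAngle f) ^ 2 := by
  obtain ⟨a, b, hψ, ha, hb⟩ := groverIteration_mulVec f j₀ m
  have hcard := Finset.card_filter_add_card_filter_not (s := (Finset.univ : Finset J))
    (fun j => f j = true)
  rw [Finset.card_univ] at hcard
  rw [groverRun, ← Matrix.mulVec_mulVec, ← Matrix.mulVec_mulVec, hψ]
  simp only [queryMatrix_groverFlip_mulVec]
  constructor
  · have h (j : J) : ‖if f j = false then groverState f a b (j, false) else 0‖ ^ 2 =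
        if ¬ f j = true then b ^ 2 else 0 := by
      cases hf : f j <;> simp [groverState, hf]
    simp only [h]
    rw [← hb, mul_pow, ← hcard, Real.sq_sqrt (by push_cast; simp), ← Finset.sum_filter,
      Finset.sum_const]
    push_cast
    simp
  · have h (j : J) : ‖if f j = true then groverState f a b (j, false) else 0‖ ^ 2 =
        if f j = true then a ^ 2 else 0 := by
      cases hf : f j <;> simp [groverState, hf]
    simp only [h]
    rw [← ha, mul_pow, Real.sq_sqrt (by simp), ← Finset.sum_filter, Finset.sum_const]
    simp

end Grover

/-! ### Operations on one of several registers -/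

section Coordinates

variable {I K : Type*} [Fintype I] [DecidableEq I] [Fintype K] [DecidableEq K]

/-- The matrix `B`, applied to one of the tensor factors. -/
def coordMatrix (i : I) (B : Matrix K K ℂ) : Matrix (I → K) (I → K) ℂ :=
  piMatrix (Function.update 1 i B)

lemma coordMatrix_mul (i : I) (A B : Matrix K K ℂ) :
    coordMatrix i A * coordMatrix i B = coordMatrix i (A * B) := by
  rw [coordMatrix, coordMatrix, piMatrix_mul, coordMatrix]
  congr 1
  funext j
  by_cases h : j = i
  · subst h; simp
  · simp [h]

lemma coordMatrix_pow (i : I) (A : Matrix K K ℂ) (m : ℕ) :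
    coordMatrix i A ^ m = coordMatrix i (A ^ m) := by
  induction m with
  | zero =>
    rw [pow_zero, pow_zero, coordMatrix,
      show Function.update (1 : I → Matrix K K ℂ) i 1 = 1 from Function.update_eq_self i (1 : I → Matrix K K ℂ)]
    exact piMatrix_one.symm
  | succ m ih => rw [pow_succ, ih, coordMatrix_mul, pow_succ]

/-- The unitary `A`, applied to one of the tensor factors. -/
def coordUnitary (i : I) (A : Matrix.unitaryGroup K ℂ) : Matrix.unitaryGroup (I → K) ℂ :=
  ⟨coordMatrix i A, piMatrix_mem_unitaryGroup _ fun j => by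
    by_cases h : j = i
    · subst h; simp
    · simp [h]⟩

end Coordinates

/-! ### Distributed Grover search with several independent registers -/

namespace Program

set_option synthInstance.maxSize 1000
set_option linter.unusedSectionVars false

variable {n b : ℕ} {S J I : Type} [Fintype S] [DecidableEq S] [Fintype J] [DecidableEq J]
  [Fintype I] [DecidableEq I] {leader : Fin n} {j₀ : J} (P : Program n b S J leader j₀)

/-- The element of `J` in the `i`-th register of the leader. -/
abbrev coordSel (J : Type) {I : Type} (i : I) (q : I → J × Bool) : J := (q i).1

/-- The initial contents of the registers of the leader. -/
abbrev coordInit (I : Type) {J : Type} (j₀ : J) : I → J × Bool := fun _ => (j₀, false)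

variable {P} {k c : ℕ}

/-- Between queries only slots that do not depend on the searched element are filled, so it is
irrelevant which register selects it. This allows queries on different registers to be composed. -/
lemma Simulates.congr_sel {Q : Type} [Fintype Q] [DecidableEq Q] {sel sel' : Q → J} {q₀ : Q}
    (hk : ∀ G j v s, P.rank s < k → P.mem G j v s = P.mem G j₀ v s) {r : ℕ}
    {V : SimpleGraph (Fin n) → Matrix Q Q ℂ} (h : P.Simulates sel q₀ k r V) :
    P.Simulates sel' q₀ k r V := by
  have hconf (G q) : P.config sel q₀ k G q = P.config sel' q₀ k G q := by
    funext v
    refine Prod.ext (Prod.ext rfl (funext fun s => ?_)) rfl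
    simp only [config, memConfig, Set.mem_ofPred_eq]
    split_ifs with hs
    · rw [hk _ _ _ _ hs, hk _ (sel' q) _ _ hs]
    · rfl
  simpa only [Simulates, embed, hconf] using h

lemma simulates_coordMatrix (hk : ∀ G j v s, P.rank s < k → P.mem G j v s = P.mem G j₀ v s)
    (i : I) (A : Matrix.unitaryGroup (J × Bool) ℂ) :
    P.Simulates (coordSel J i) (coordInit I j₀) k 2 fun _ => coordMatrix i A :=
  simulates_unitary hk (coordUnitary i A)

lemma simulates_queryMatrix (hkc : k ≤ c) (hc : ∀ s, P.rank s < c)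
    (answer : Memory n b S → Bool) (A : Bool → Matrix.unitaryGroup (J × Bool) ℂ)
    (hA : ∀ x k k', (A x : Matrix (J × Bool) (J × Bool) ℂ) k k' ≠ 0 → k.1 = k'.1) (i : I) :
    P.Simulates (coordSel J i) (coordInit I j₀) k (10 * P.slotCount k c + 2)
      fun G => coordMatrix i (queryMatrix (fun j => answer (P.mem G j leader)) A) := by
  convert simulates_query (q₀ := coordInit I j₀) (sel := coordSel J i) rfl hkc hc answer
    (fun x => coordUnitary i (A x)) (fun x q q' h => ?_) using 2 with G
  · ext q q'
    simp only [coordUnitary, coordMatrix, piMatrix, queryMatrix, Matrix.of_apply]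
    refine Finset.prod_congr rfl fun j _ => ?_
    by_cases h : j = i
    · subst h; simp
    · simp [h]
  · refine hA x _ _ fun h0 => h ?_
    simp only [coordUnitary, coordMatrix, piMatrix, Matrix.of_apply]
    exact Finset.prod_eq_zero (Finset.mem_univ i) (by simpa using h0)

lemma simulates_groverRun (hk : ∀ G j v s, P.rank s < k → P.mem G j v s = P.mem G j₀ v s)
    (hkc : k ≤ c) (hc : ∀ s, P.rank s < c) (answer : Memory n b S → Bool) (i : I) (m : ℕ) :
    P.Simulates (coordSel J i) (coordInit I j₀) k ((m + 1) * (10 * P.slotCount k c + 4))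
      fun G => coordMatrix i (groverRun (fun j => answer (P.mem G j leader)) j₀ m) := by
  have h1 := simulates_coordMatrix hk i (groverInit j₀)
  have h2 := (simulates_queryMatrix hkc hc answer (groverPhase J)
    (fun x k k' => groverPhase_apply_ne) i).mul (simulates_coordMatrix hk i (groverDiffusion J))
  have h3 := simulates_queryMatrix hkc hc answer (groverFlip J)
    (fun x k k' => groverFlip_apply_ne) i
  have h := (h1.mul (h2.pow m)).mul h3
  simp only [coordMatrix_mul, coordMatrix_pow] at h
  -- Initialisation, `m` pairs of a phase query and a diffusion, and one query that sets the flag.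
  have hr : (m + 1) * (10 * P.slotCount k c + 4) =
      2 + m * (10 * P.slotCount k c + 2 + 2) + (10 * P.slotCount k c + 2) := by ring
  rw [hr]
  exact h

/-- The registers are treated one after the other: the rounds add up, while the matrices multiply to
a tensor product. -/
lemma simulates_prod (i₀ : I) (hk : ∀ G j v s, P.rank s < k → P.mem G j v s = P.mem G j₀ v s)
    (r : I → ℕ) (B : I → SimpleGraph (Fin n) → Matrix (J × Bool) (J × Bool) ℂ)
    (h : ∀ i, P.Simulates (coordSel J i) (coordInit I j₀) k (r i) fun G => coordMatrix i (B i G)) :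
    P.Simulates (coordSel J i₀) (coordInit I j₀) k (∑ i, r i)
      fun G => piMatrix fun i => B i G := by
  have key (s : Finset I) : P.Simulates (coordSel J i₀) (coordInit I j₀) k (∑ i ∈ s, r i)
      fun G => piMatrix fun i => if i ∈ s then B i G else 1 := by
    induction s using Finset.induction_on with
    | empty => simpa [piMatrix_one] using simulates_one
    | insert i s hi ih =>
      rw [Finset.sum_insert hi, add_comm]
      convert ih.mul ((h i).congr_sel hk) using 2 with G
      rw [coordMatrix, piMatrix_mul]
      congr 1
      funext j
      by_cases hj : j = i
      · subst hj; simp [hi]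
      · simp [hj]
  simpa using key Finset.univ

open Classical in
lemma sum_norm_embed {Q : Type} [Fintype Q] [DecidableEq Q] (sel : Q → J) (q₀ : Q)
    (G : SimpleGraph (Fin n)) (ψ : Q → ℂ)
    (p : Config n b (Q × Memory n b S) → Prop) :
    ∑ x with p x, ‖P.embed sel q₀ k G ψ x‖ ^ 2 =
      ∑ q with p (P.config sel q₀ k G q), ‖ψ q‖ ^ 2 := by
  rw [Finset.sum_filter, Finset.sum_filter]
  refine (Fintype.sum_of_injective _ (P.config_injective sel q₀ k G) _ _ (fun x hx => ?_)
    fun q => ?_).symm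
  · rw [P.embed_eq_zero]
    · simp
    · rintro q rfl
      exact hx ⟨q, rfl⟩
  · rw [P.embed_config]

lemma sum_prod_flags (ψ : I → J × Bool → ℂ) :
    (∑ q : I → J × Bool with ∀ i, (q i).2 = false, ‖∏ i, ψ i (q i)‖ ^ 2 =
      ∏ i, ∑ j, ‖ψ i (j, false)‖ ^ 2) ∧
    ∑ q : I → J × Bool, ‖∏ i, ψ i (q i)‖ ^ 2 =
      ∏ i, (∑ j, ‖ψ i (j, false)‖ ^ 2 + ∑ j, ‖ψ i (j, true)‖ ^ 2) := by
  constructor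
  · have h (i : I) : ∑ j, ‖ψ i (j, false)‖ ^ 2 =
        ∑ k : J × Bool, if k.2 = false then ‖ψ i k‖ ^ 2 else 0 := by
      simp [Fintype.sum_prod_type]
    simp only [h]
    rw [Finset.prod_univ_sum, Fintype.piFinset_univ, Finset.sum_filter]
    refine Finset.sum_congr rfl fun q _ => ?_
    rw [norm_prod, ← Finset.prod_pow]
    split_ifs with hq
    · exact Finset.prod_congr rfl fun i _ => by rw [if_pos (hq i)]
    · push Not at hq
      obtain ⟨i, hi⟩ := hq
      exact (Finset.prod_eq_zero (Finset.mem_univ i) (if_neg hi)).symm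
  · have h (i : I) : ∑ j, ‖ψ i (j, false)‖ ^ 2 + ∑ j, ‖ψ i (j, true)‖ ^ 2 =
        ∑ k : J × Bool, ‖ψ i k‖ ^ 2 := by
      rw [Fintype.sum_prod_type, ← Finset.sum_add_distrib]
      simp [add_comm]
    simp only [h]
    rw [Finset.prod_univ_sum, Fintype.piFinset_univ]
    refine Finset.sum_congr rfl fun q _ => ?_
    rw [norm_prod, ← Finset.prod_pow]

/-- Grover search by the leader, for an element of `J` for which the program gives the answer
`true`. The slots of rank less than `k`, which do not depend on the element, are filled only
once. -/
theorem exists_protocol_search [Nonempty I]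
    (hk : ∀ G j v s, P.rank s < k → P.mem G j v s = P.mem G j₀ v s)
    (hkc : k ≤ c) (hc : ∀ s, P.rank s < c) (answer : Memory n b S → Bool) (m : I → ℕ) :
    ∃ A : Protocol n b,
      A.rounds ≤ 5 * P.slotCount 0 k + ∑ i, (m i + 1) * (10 * P.slotCount k c + 4) ∧
      ∀ G, A.outputProb G {o | ∀ v, o v = false} =
          ∏ i, Real.cos ((2 * m i + 1) * groverAngle fun j => answer (P.mem G j leader)) ^ 2 ∧
        A.outputProb G {o | ∃ v, o v = true} =
          1 - ∏ i, Real.cos ((2 * m i + 1) *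
            groverAngle fun j => answer (P.mem G j leader)) ^ 2 := by
  classical
  obtain ⟨i₀⟩ := ‹Nonempty I›
  obtain ⟨U, V, hU, -, hUx, -⟩ :=
    P.transports_config (coordSel J i₀) (coordInit I j₀) rfl (Nat.zero_le k)
  obtain ⟨U', hU', hUV⟩ := simulates_prod i₀ hk _ _
    fun i => simulates_groverRun hk hkc hc answer i (m i)
  obtain ⟨l, hl, hlU⟩ := hU.mul hU'
  refine ⟨protocolOfRounds l (coordInit I j₀, fun _ _ _ => false)
    (fun v x => decide (v = leader ∧ ∃ i, (x.1.1 i).2 = true)), hl, fun G => ?_⟩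
  set f : J → Bool := fun j => answer (P.mem G j leader) with hf
  set ψ : I → J × Bool → ℂ := fun i => groverRun f j₀ (m i) *ᵥ Pi.single (j₀, false) 1 with hψ
  have hstate : roundsMatrix G l *ᵥ
      Pi.single (fun _ => ((coordInit I j₀, fun _ _ _ => false), fun _ _ => false)) 1 =
      P.embed (coordSel J i₀) (coordInit I j₀) k G fun q => ∏ i, ψ i (q i) := by
    have h0 : (fun _ => ((coordInit I j₀, fun _ _ _ => false), fun _ _ => false)) =
        P.config (coordSel J i₀) (coordInit I j₀) 0 G (coordInit I j₀) := by
      funext v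
      simp [config, memConfig]
    have h1 : Pi.single (P.config (coordSel J i₀) (coordInit I j₀) k G (coordInit I j₀)) 1 =
        P.embed (coordSel J i₀) (coordInit I j₀) k G (Pi.single (coordInit I j₀) 1) := by
      simp [embed, Pi.single_apply]
    rw [hlU, h0, ← Matrix.mulVec_mulVec, hUx, h1, hUV, single_eq_prod, piMatrix_mulVec_prod]
  have hprob (E : Set (Fin n → Bool)) :
      (protocolOfRounds l (coordInit I j₀, fun _ _ _ => false)
        (fun v x => decide (v = leader ∧ ∃ i, (x.1.1 i).2 = true))).outputProb G E =
      ∑ q : I → J × Bool with (fun v => decide (v = leader ∧ ∃ i, (q i).2 = true)) ∈ E,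
        ‖∏ i, ψ i (q i)‖ ^ 2 := by
    rw [Protocol.outputProb, protocolOfRounds_finalState, hstate]
    refine (sum_norm_embed (coordSel J i₀) (coordInit I j₀) G _ fun x =>
      (fun v => decide (v = leader ∧ ∃ i, ((x v).1.1 i).2 = true)) ∈ E).trans ?_
    congr 1
    ext q
    simp only [Finset.mem_filter_univ]
    have : (fun v => decide (v = leader ∧ ∃ i,
        ((P.config (coordSel J i₀) (coordInit I j₀) k G q v).1.1 i).2 = true)) =
        fun v => decide (v = leader ∧ ∃ i, (q i).2 = true) := by
      funext v
      by_cases hv : v = leader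
      · simp [config, memConfig, hv]
      · simp [hv]
    rw [this]
  have hall : ∑ q : I → J × Bool with ∀ i, (q i).2 = false, ‖∏ i, ψ i (q i)‖ ^ 2 =
      ∏ i, Real.cos ((2 * m i + 1) * groverAngle f) ^ 2 := by
    rw [(sum_prod_flags ψ).1]
    exact Finset.prod_congr rfl fun i _ => (sum_groverRun f j₀ (m i)).1
  constructor
  · rw [hprob, ← hall]
    congr 1
    ext q
    simp
  -- The total mass is `∏ (cos² + sin²) = 1`, so the second event is treated as the complement of
  -- the first.
  · have htotal : ∑ q : I → J × Bool, ‖∏ i, ψ i (q i)‖ ^ 2 = 1 := by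
      rw [(sum_prod_flags ψ).2]
      refine Finset.prod_eq_one fun i _ => ?_
      rw [(sum_groverRun f j₀ (m i)).1, (sum_groverRun f j₀ (m i)).2, Real.cos_sq_add_sin_sq]
    rw [hprob, ← hall, ← htotal,
      ← Finset.sum_filter_add_sum_filter_not Finset.univ fun q : I → J × Bool => ∀ i, (q i).2 = false,
      add_sub_cancel_left]
    congr 1
    ext q
    simp

end Program

/-! ### Searching with an unknown number of marked elements -/

section Angles

variable {J : Type} [Fintype J]

lemma groverAngle_eq_zero {f : J → Bool} (hf : ∀ j, f j = false) : groverAngle f = 0 := by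
  simp [groverAngle, hf]

lemma groverAngle_le (f : J → Bool) : groverAngle f ≤ Real.pi / 2 := Real.arcsin_le_pi_div_two _

lemma le_groverAngle {f : J → Bool} {j : J} (hj : f j = true) :
    1 / √(Fintype.card J) ≤ groverAngle f := by
  have hN : 0 < Fintype.card J := Fintype.card_pos_iff.mpr ⟨j⟩
  have ht : 1 ≤ (Finset.univ.filter fun j => f j = true).card :=
    Finset.card_pos.mpr ⟨j, by simpa using hj⟩
  have htN : (Finset.univ.filter fun j => f j = true).card ≤ Fintype.card J :=
    Finset.card_le_univ _
  have h1 : √(((Finset.univ.filter fun j => f j = true).card : ℝ) / Fintype.card J) ≤ 1 := by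
    refine Real.sqrt_le_one.mpr ((div_le_one (by exact_mod_cast hN)).mpr ?_)
    exact_mod_cast htN
  have h2 := Real.sqrt_nonneg
    (((Finset.univ.filter fun j => f j = true).card : ℝ) / Fintype.card J)
  have h0 : 0 ≤ groverAngle f := Real.arcsin_nonneg.mpr h2
  -- The angle is at least its sine, which is `√(t / N)` with `t ≥ 1` marked elements.
  refine le_trans ?_ (Real.sin_le h0)
  rw [groverAngle, Real.sin_arcsin (by linarith) h1,
    ← Real.sqrt_one, ← Real.sqrt_div zero_le_one]
  refine Real.sqrt_le_sqrt ?_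
  gcongr
  exact_mod_cast ht

/-- Some power of three, up to the root of the size of the search space, is a good number of
rotations. -/
lemma exists_cos_sq_le {f : J → Bool} {j : J} (hj : f j = true) (E : ℕ)
    (hE : Fintype.card J ≤ 9 ^ E) :
    ∃ e ≤ E, Real.cos (3 ^ e * groverAngle f) ^ 2 ≤ 1 / 2 := by
  classical
  have hN : (0 : ℝ) < Fintype.card J := by exact_mod_cast Fintype.card_pos_iff.mpr ⟨j⟩
  have hs : √(Fintype.card J) ≤ 3 ^ E := by
    refine Real.sqrt_le_iff.mpr ⟨by positivity, ?_⟩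
    rw [← pow_mul, mul_comm, pow_mul]
    norm_num
    exact_mod_cast hE
  have hlast : Real.pi / 4 ≤ 3 ^ E * groverAngle f := by
    have h1 : 1 ≤ 3 ^ E * (1 / √(Fintype.card J)) := by
      rw [mul_one_div, one_le_div (Real.sqrt_pos.mpr hN)]
      exact hs
    have h2 : 3 ^ E * (1 / √(Fintype.card J)) ≤ 3 ^ E * groverAngle f :=
      mul_le_mul_of_nonneg_left (le_groverAngle hj) (by positivity)
    linarith [Real.pi_le_four]
  -- The least such `e` works: by minimality tripling overshoots to at most `3π/4`, and for `e = 0`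
  -- the angle is at most `π/2`. On `[π/4, 3π/4]` the squared cosine is at most `1/2`.
  have hex : ∃ e, Real.pi / 4 ≤ 3 ^ e * groverAngle f := ⟨E, hlast⟩
  refine ⟨Nat.find hex, Nat.find_min' hex hlast, ?_⟩
  have hlow := Nat.find_spec hex
  have hup : 3 ^ Nat.find hex * groverAngle f ≤ 3 * (Real.pi / 4) := by
    rcases h : Nat.find hex with _ | e
    · linarith [groverAngle_le f, Real.pi_pos]
    · have := Nat.find_min hex (m := e) (by omega)
      rw [pow_succ]
      push Not at this
      linarith
  have hcos : Real.cos (2 * (3 ^ Nat.find hex * groverAngle f)) ≤ 0 :=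
    Real.cos_nonpos_of_pi_div_two_le_of_le (by linarith) (by linarith)
  rw [Real.cos_sq]
  linarith

/-- The number of Grover iterations that rotates by `3 ^ e` times the angle. -/
def geometricIterations {E r : ℕ} (i : Fin (E + 1) × Fin r) : ℕ := (3 ^ (i.1 : ℕ) - 1) / 2

lemma two_mul_geometricIterations {E r : ℕ} (i : Fin (E + 1) × Fin r) :
    2 * (geometricIterations i : ℝ) + 1 = 3 ^ (i.1 : ℕ) := by
  have h : 2 * geometricIterations i + 1 = 3 ^ (i.1 : ℕ) := by
    obtain ⟨x, hx⟩ : Odd (3 ^ (i.1 : ℕ)) := Odd.pow (by decide)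
    rw [geometricIterations, hx]
    omega
  exact_mod_cast h

lemma geometricIterations_le {E r : ℕ} (i : Fin (E + 1) × Fin r) :
    geometricIterations i + 1 ≤ 3 ^ E := by
  have h1 : 3 ^ (i.1 : ℕ) ≤ 3 ^ E := Nat.pow_le_pow_right (by norm_num) (by omega)
  have h2 : 0 < 3 ^ (i.1 : ℕ) := by positivity
  rw [geometricIterations]
  omega

lemma prod_cos_sq_le {f : J → Bool} {j : J} (hj : f j = true) (E r : ℕ)
    (hE : Fintype.card J ≤ 9 ^ E) :
    ∏ i : Fin (E + 1) × Fin r, Real.cos ((2 * geometricIterations i + 1) * groverAngle f) ^ 2 ≤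
      (1 / 2) ^ r := by
  obtain ⟨e, heE, he⟩ := exists_cos_sq_le hj E hE
  simp only [two_mul_geometricIterations]
  rw [Fintype.prod_prod_type, Finset.prod_comm]
  calc ∏ _y : Fin r, ∏ x : Fin (E + 1), Real.cos (3 ^ (x : ℕ) * groverAngle f) ^ 2
      ≤ ∏ _y : Fin r, (1 / 2 : ℝ) := by
        refine Finset.prod_le_prod (fun _ _ => Finset.prod_nonneg fun _ _ => sq_nonneg _)
          fun _ _ => ?_
        -- Keep only the factor of the good exponent; the others are at most `1`.
        rw [← Finset.mul_prod_erase _ _ (Finset.mem_univ (⟨e, by omega⟩ : Fin (E + 1)))]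
        refine (mul_le_of_le_one_right (sq_nonneg _) ?_).trans he
        exact Finset.prod_le_one (fun _ _ => sq_nonneg _) fun _ _ => Real.cos_sq_le_one _
    _ = (1 / 2) ^ r := by simp

end Angles

namespace Program

variable {n b : ℕ} {S J : Type} [Fintype S] [DecidableEq S] [Fintype J] [DecidableEq J]
  {leader : Fin n} {j₀ : J} {P : Program n b S J leader j₀} {k c : ℕ}

/-- If the program reduces `p`-clique detection to a search, then it gives rise to a quantum
protocol for `p`-clique detection. -/
theorem exists_protocol_clique {p : ℕ}
    (hk : ∀ G j v s, P.rank s < k → P.mem G j v s = P.mem G j₀ v s)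
    (hkc : k ≤ c) (hc : ∀ s, P.rank s < c) (answer : Memory n b S → Bool)
    (hanswer : ∀ G, (∃ j, answer (P.mem G j leader) = true) ↔ ¬ G.CliqueFree p)
    (E r : ℕ) (hE : Fintype.card J ≤ 9 ^ E) :
    ∃ A : Protocol n b,
      A.rounds ≤ 5 * P.slotCount 0 k +
        (E + 1) * (r + 1) * (3 ^ E * (10 * P.slotCount k c + 4)) ∧
      ∀ G, 1 - (1 / 2) ^ (r + 1) ≤ A.outputProb G (correctOutputs p G) := by
  obtain ⟨A, hA, hprob⟩ := exists_protocol_search hk hkc hc answer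
    (geometricIterations (E := E) (r := r + 1))
  refine ⟨A, hA.trans ?_, fun G => ?_⟩
  · gcongr
    refine (Finset.sum_le_card_nsmul _ _ (3 ^ E * (10 * P.slotCount k c + 4)) fun i _ => ?_).trans ?_
    · exact Nat.mul_le_mul_right _ (geometricIterations_le i)
    · simp
  · by_cases h : G.CliqueFree p
    · have hE : correctOutputs p G = {o | ∀ v, o v = false} := by
        ext o; simp [correctOutputs, h]
      have hf (j : J) : answer (P.mem G j leader) = false := by
        by_contra hj
        exact (hanswer G).mp ⟨j, by simpa using hj⟩ h
      -- With nothing marked the angle is `0`, all cosines are `1`, and there is no error.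
      rw [hE, (hprob G).1, groverAngle_eq_zero hf]
      simp
    · have hE' : correctOutputs p G = {o | ∃ v, o v = true} := by
        ext o; simp [correctOutputs, h]
      obtain ⟨j, hj⟩ := (hanswer G).mpr h
      rw [hE', (hprob G).2]
      have := prod_cos_sq_le (f := fun j => answer (P.mem G j leader)) hj E (r + 1) hE
      linarith

end Program

/-! ### Routing through relays -/

/-- A set of demands: `(u, a, y)` stands for a bit about `y` that `a` has to send to `u`. -/
abbrev Demands (n : ℕ) : Type := Finset (Fin n × Fin n × Fin n)

section Routing

variable {n : ℕ}

/-- Two demands of the same colour have different receivers and different senders. Thus all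
demands of colour `(τ, r)` can be relayed at time `τ` by node `r`. -/
def IsRouting {T : ℕ} (R : Demands n) (col : Fin n × Fin n × Fin n → Fin T × Fin n) : Prop :=
  ∀ m ∈ R, ∀ m' ∈ R, col m = col m' → m.1 = m'.1 ∨ m.2.1 = m'.2.1 → m = m'

/-- Greedy edge colouring of the bipartite multigraph of senders and receivers: a new demand
conflicts with at most `2 * (D - 1)` coloured ones, fewer than the `T * n` colours. -/
lemma exists_isRouting (R : Demands n) (D T : ℕ) (hT : 0 < T * n) (hD : 2 * D ≤ T * n)
    (hdst : ∀ u, (R.filter fun m => m.1 = u).card ≤ D)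
    (hsrc : ∀ a, (R.filter fun m => m.2.1 = a).card ≤ D) :
    ∃ col : Fin n × Fin n × Fin n → Fin T × Fin n, IsRouting R col := by
  have hcard : Fintype.card (Fin T × Fin n) = T * n := by simp
  have key (s : Demands n) (hs : s ⊆ R) :
      ∃ col : Fin n × Fin n × Fin n → Fin T × Fin n, IsRouting s col := by
    induction s using Finset.induction_on with
    | empty =>
      obtain ⟨x⟩ := Fintype.card_pos_iff.mp (hcard ▸ hT)
      exact ⟨fun _ => x, by simp [IsRouting]⟩
    | insert m s hm ih =>
      obtain ⟨hmR, hsR⟩ := Finset.insert_subset_iff.mp hs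
      obtain ⟨col, hcol⟩ := ih hsR
      have h1 : (s.filter fun m' => m'.1 = m.1).card + 1 ≤ D := by
        refine le_trans ?_ (hdst m.1)
        rw [← Finset.card_insert_of_notMem (a := m) (by simp [hm])]
        refine Finset.card_le_card fun x hx => ?_
        rcases Finset.mem_insert.mp hx with rfl | hx
        · simp [hmR]
        · have := Finset.mem_filter.mp hx
          simp [hsR this.1, this.2]
      have h2 : (s.filter fun m' => m'.2.1 = m.2.1).card + 1 ≤ D := by
        refine le_trans ?_ (hsrc m.2.1)
        rw [← Finset.card_insert_of_notMem (a := m) (by simp [hm])]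
        refine Finset.card_le_card fun x hx => ?_
        rcases Finset.mem_insert.mp hx with rfl | hx
        · simp [hmR]
        · have := Finset.mem_filter.mp hx
          simp [hsR this.1, this.2]
      have h3 : ((s.filter fun m' => m'.1 = m.1 ∨ m'.2.1 = m.2.1).image col).card <
          (Finset.univ : Finset (Fin T × Fin n)).card := by
        rw [Finset.card_univ, hcard]
        refine lt_of_le_of_lt Finset.card_image_le ?_
        rw [Finset.filter_or]
        have := Finset.card_union_le (s.filter fun m' => m'.1 = m.1)
          (s.filter fun m' => m'.2.1 = m.2.1)
        omega
      obtain ⟨x, -, hx⟩ := Finset.exists_mem_notMem_of_card_lt_card h3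
      have hx' (m') (hm' : m' ∈ s) (h : m'.1 = m.1 ∨ m'.2.1 = m.2.1) : col m' ≠ x :=
        fun hc => hx (Finset.mem_image.mpr ⟨m', Finset.mem_filter.mpr ⟨hm', h⟩, hc⟩)
      refine ⟨Function.update col m x, fun m₁ h₁ m₂ h₂ hc h => ?_⟩
      by_cases e₁ : m₁ = m <;> by_cases e₂ : m₂ = m
      · rw [e₁, e₂]
      · subst e₁
        rw [Function.update_self, Function.update_of_ne e₂] at hc
        exact absurd hc.symm (hx' m₂ ((Finset.mem_insert.mp h₂).resolve_left e₂)
          (h.imp Eq.symm Eq.symm))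
      · subst e₂
        rw [Function.update_self, Function.update_of_ne e₁] at hc
        exact absurd hc (hx' m₁ ((Finset.mem_insert.mp h₁).resolve_left e₁) h)
      · rw [Function.update_of_ne e₁, Function.update_of_ne e₂] at hc
        exact hcol m₁ ((Finset.mem_insert.mp h₁).resolve_left e₁) m₂
          ((Finset.mem_insert.mp h₂).resolve_left e₂) hc h
  exact key R subset_rfl

open Classical in
/-- A message that encodes a truth value. -/
def bitMessage (b : ℕ) (p : Prop) : Message b := fun _ => decide p

lemma bitMessage_eq_true_iff {b : ℕ} (hb : 0 < b) (p : Prop) :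
    bitMessage b p = bitMessage b True ↔ p := by
  refine ⟨fun h => ?_, fun h => by simp [h]⟩
  simpa [bitMessage] using congrFun h ⟨0, hb⟩

/-- The bit that `r` gets from `a` when it relays the demands of colour `(τ, r)`. -/
def relayBit {T : ℕ} (R : Demands n) (col : Fin n × Fin n × Fin n → Fin T × Fin n)
    (τ : Fin T) (a r : Fin n) (adj : Fin n → Prop) : Prop :=
  ∃ m ∈ R, m.2.1 = a ∧ col m = (τ, r) ∧ adj m.2.2

/-- The bit that `u` gets from `r` when `r` relays the demands of colour `(τ, r)`, in terms of
the bits that `r` got. -/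
def deliverBit {T : ℕ} (R : Demands n) (col : Fin n × Fin n × Fin n → Fin T × Fin n)
    (τ : Fin T) (r u : Fin n) (got : Fin n → Prop) : Prop :=
  ∃ m ∈ R, m.1 = u ∧ col m = (τ, r) ∧ got m.2.1

/-- Within one colour the receiver determines the demand, and so does the sender. Hence both
existential statements have only `(u, a, y)` as a possible witness, and the relay passes on
precisely its bit. -/
lemma deliverBit_relayBit {T : ℕ} {R : Demands n} {col : Fin n × Fin n × Fin n → Fin T × Fin n}
    (h : IsRouting R col) (G : SimpleGraph (Fin n)) {u a y : Fin n} (hm : (u, a, y) ∈ R) :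
    deliverBit R col (col (u, a, y)).1 (col (u, a, y)).2 u
      (fun a' => relayBit R col (col (u, a, y)).1 a' (col (u, a, y)).2 (G.Adj a')) ↔
      G.Adj a y := by
  constructor
  · rintro ⟨m, hmR, hu, hc, m', hm'R, ha, hc', hadj⟩
    have h1 : m = (u, a, y) := h m hmR _ hm hc (Or.inl hu)
    have h2 : m' = m := h m' hm'R m hmR (hc'.trans hc.symm) (Or.inr ha)
    subst h1
    subst h2
    exact hadj
  · exact fun hadj => ⟨_, hm, rfl, rfl, _, hm, rfl, rfl, hadj⟩

end Routing

/-! ### The classical program evaluated in a query -/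

section CliqueProgram

/-- The slots of the memory: two hops for the demands that are served once, one slot for the
element of the search space (`false`) and one for the answers (`true`), and two hops for the
demands of this element. -/
abbrev Slot (T₁ T₂ : ℕ) : Type := (Bool × Fin T₁) ⊕ (Bool ⊕ (Bool × Fin T₂))

/-- The order in which the slots are filled. -/
def slotRank {T₁ T₂ : ℕ} : Slot T₁ T₂ → ℕ
  | .inl (false, _) => 0
  | .inl (true, _) => 1
  | .inr (.inl false) => 2
  | .inr (.inr (false, _)) => 3
  | .inr (.inr (true, _)) => 4
  | .inr (.inl true) => 5

variable {n : ℕ}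

/-- There is a clique that consists of `d` nodes in `S` and one node in `B`. The relations `R₁`
and `R₂` give the adjacency within `S` and between `S` and `B`, respectively. -/
def CliqueFound (d : ℕ) (S B : Finset (Fin n)) (R₁ R₂ : Fin n → Fin n → Prop) : Prop :=
  ∃ s ⊆ S, s.card = d ∧ (∀ a ∈ s, ∀ y ∈ s, a ≠ y → R₁ a y) ∧ ∃ w ∈ B, ∀ a ∈ s, R₂ a w

lemma cliqueFound_congr {d : ℕ} {S B : Finset (Fin n)} {R₁ R₂ R₁' R₂' : Fin n → Fin n → Prop}
    (h₁ : ∀ a ∈ S, ∀ y ∈ S, R₁ a y ↔ R₁' a y) (h₂ : ∀ a ∈ S, ∀ w ∈ B, R₂ a w ↔ R₂' a w) :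
    CliqueFound d S B R₁ R₂ ↔ CliqueFound d S B R₁' R₂' := by
  refine exists_congr fun s => and_congr_right fun hs => and_congr_right fun _ => and_congr ?_ ?_
  · exact forall₂_congr fun a ha => forall₂_congr fun y hy => by rw [h₁ a (hs ha) y (hs hy)]
  · exact exists_congr fun w => and_congr_right fun hw => forall₂_congr fun a ha =>
      h₂ a (hs ha) w hw

/-- Any node of a clique can serve as `w`, and the rest is covered by assumption. Conversely, `S u`
and `B u j` may overlap: adjacency to all of `s` already forces `w ∉ s`. -/
lemma exists_cliqueFound_iff {J : Type} {d : ℕ} {S : Fin n → Finset (Fin n)}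
    {B : Fin n → J → Finset (Fin n)}
    (hcover : ∀ s : Finset (Fin n), s.card = d → ∀ w, ∃ u j, s ⊆ S u ∧ w ∈ B u j)
    (G : SimpleGraph (Fin n)) :
    (∃ j u, CliqueFound d (S u) (B u j) G.Adj G.Adj) ↔ ¬ G.CliqueFree (d + 1) := by
  rw [SimpleGraph.CliqueFree]
  push Not
  constructor
  · rintro ⟨j, u, s, -, hs, hadj, w, -, hw⟩
    refine ⟨insert w s, ?_⟩
    have : G.IsNClique d s := ⟨fun a ha y hy h => hadj a ha y hy h, hs⟩
    exact this.insert fun a ha => (hw a ha).symm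
  · rintro ⟨t, ht⟩
    obtain ⟨w, hw⟩ : t.Nonempty := by
      rw [← Finset.card_pos, ht.card_eq]; omega
    have hcard : (t.erase w).card = d := by
      rw [Finset.card_erase_of_mem hw, ht.card_eq, Nat.add_sub_cancel]
    obtain ⟨u, j, hs, hwB⟩ := hcover (t.erase w) hcard w
    refine ⟨j, u, t.erase w, hs, hcard, fun a ha y hy h => ?_, w, hwB, fun a ha => ?_⟩
    · exact ht.isClique (Finset.mem_of_mem_erase ha) (Finset.mem_of_mem_erase hy) h
    · exact ht.isClique (Finset.mem_of_mem_erase ha) hw (Finset.ne_of_mem_erase ha)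

/-- The demands that let `u` learn the adjacency between `S u` and `Y u`. -/
def demands (S Y : Fin n → Finset (Fin n)) : Demands n :=
  Finset.univ.filter fun m => m.2.1 ∈ S m.1 ∧ m.2.2 ∈ Y m.1

lemma card_demands_dst (S Y : Fin n → Finset (Fin n)) (u : Fin n) :
    ((demands S Y).filter fun m => m.1 = u).card ≤ (S u).card * (Y u).card := by
  rw [← Finset.card_product]
  refine Finset.card_le_card_of_injOn (fun m => m.2) (fun m hm => ?_) fun m hm m' hm' h => ?_
  · simp [demands] at hm ⊢
    obtain ⟨⟨h1, h2⟩, rfl⟩ := hm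
    exact ⟨h1, h2⟩
  · simp at hm hm'
    exact Prod.ext (hm.2.trans hm'.2.symm) h

lemma card_demands_src (S Y : Fin n → Finset (Fin n)) (a : Fin n) (L : ℕ)
    (hY : ∀ u, (Y u).card ≤ L) :
    ((demands S Y).filter fun m => m.2.1 = a).card ≤
      (Finset.univ.filter fun u => a ∈ S u).card * L := by
  have h : ((demands S Y).filter fun m => m.2.1 = a).card ≤
      ((Finset.univ.filter fun u => a ∈ S u).sigma Y).card := by
    refine Finset.card_le_card_of_injOn (fun m => ⟨m.1, m.2.2⟩) (fun m hm => ?_)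
      fun m hm m' hm' h => ?_
    · simp [demands] at hm ⊢
      obtain ⟨⟨h1, h2⟩, rfl⟩ := hm
      exact ⟨h1, h2⟩
    · simp at hm hm' h
      exact Prod.ext h.1 (Prod.ext (hm.2.trans hm'.2.symm) h.2)
  refine h.trans ?_
  rw [Finset.card_sigma]
  exact (Finset.sum_le_card_nsmul _ _ L fun u _ => hY u).trans (by simp)

variable {b T₁ T₂ : ℕ} {J : Type}

/-- The bit that `u` learns in the second hop. -/
def learnedBit {T : ℕ} (R : Demands n) (col : Fin n × Fin n × Fin n → Fin T × Fin n)
    (G : SimpleGraph (Fin n)) (τ : Fin T) (r u : Fin n) : Prop :=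
  deliverBit R col τ r u fun a => relayBit R col τ a r (G.Adj a)

/-- The adjacency relation that `u` reads off the bits that it has learned. -/
def readBit {T : ℕ} (col : Fin n × Fin n × Fin n → Fin T × Fin n) (u : Fin n)
    (M : Fin T → Fin n → Message b) (a y : Fin n) : Prop :=
  M (col (u, a, y)).1 (col (u, a, y)).2 = bitMessage b True

lemma readBit_iff (hb : 0 < b) {T : ℕ} {R : Demands n}
    {col : Fin n × Fin n × Fin n → Fin T × Fin n} (h : IsRouting R col)
    (G : SimpleGraph (Fin n)) (u : Fin n) (M : Fin T → Fin n → Message b)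
    (hM : ∀ τ r, M τ r = bitMessage b (learnedBit R col G τ r u)) {a y : Fin n}
    (hm : (u, a, y) ∈ R) : readBit col u M a y ↔ G.Adj a y := by
  rw [readBit, hM, bitMessage_eq_true_iff hb]
  exact deliverBit_relayBit h G hm

/-- The final contents of the memories in the program for clique detection. -/
def cliqueMem (d : ℕ) (S : Fin n → Finset (Fin n)) (B : Fin n → J → Finset (Fin n))
    (col₁ : Fin n × Fin n × Fin n → Fin T₁ × Fin n)
    (col₂ : J → Fin n × Fin n × Fin n → Fin T₂ × Fin n)
    (leader : Fin n) (j₀ : J) (enc : J → Message b) (G : SimpleGraph (Fin n)) (j : J)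
    (v : Fin n) : Memory n b (Slot T₁ T₂)
  | .inl (false, τ), u => bitMessage b (relayBit (demands S S) col₁ τ u v (G.Adj u))
  | .inl (true, τ), u => bitMessage b (learnedBit (demands S S) col₁ G τ u v)
  | .inr (.inl false), u => enc (if u = leader then j else j₀)
  | .inr (.inr (false, τ)), u =>
    bitMessage b (relayBit (demands S (B · j)) (col₂ j) τ u v (G.Adj u))
  | .inr (.inr (true, τ)), u => bitMessage b (learnedBit (demands S (B · j)) (col₂ j) G τ u v)
  | .inr (.inl true), u => bitMessage b (CliqueFound d (S u) (B u j) G.Adj G.Adj)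

/-- The messages sent in the program for clique detection. -/
def cliqueSend (d : ℕ) (S : Fin n → Finset (Fin n)) (B : Fin n → J → Finset (Fin n))
    (col₁ : Fin n × Fin n × Fin n → Fin T₁ × Fin n)
    (col₂ : J → Fin n × Fin n × Fin n → Fin T₂ × Fin n)
    (leader : Fin n) (enc : J → Message b) (dec : Message b → J) :
    Slot T₁ T₂ → Fin n → Set (Fin n) → J → Memory n b (Slot T₁ T₂) → Fin n → Message b
  | .inl (false, τ), u, N, _, _, v =>
    bitMessage b (relayBit (demands S S) col₁ τ u v (· ∈ N))
  | .inl (true, τ), u, _, _, M, v =>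
    bitMessage b (deliverBit (demands S S) col₁ τ u v fun a =>
      M (.inl (false, τ)) a = bitMessage b True)
  | .inr (.inl false), _, _, j, _, _ => enc j
  | .inr (.inr (false, τ)), u, N, _, M, v =>
    let j := dec (M (.inr (.inl false)) leader)
    bitMessage b (relayBit (demands S (B · j)) (col₂ j) τ u v (· ∈ N))
  | .inr (.inr (true, τ)), u, _, _, M, v =>
    let j := dec (M (.inr (.inl false)) leader)
    bitMessage b (deliverBit (demands S (B · j)) (col₂ j) τ u v fun a =>
      M (.inr (.inr (false, τ))) a = bitMessage b True)
  | .inr (.inl true), u, _, _, M, _ =>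
    let j := dec (M (.inr (.inl false)) leader)
    bitMessage b (CliqueFound d (S u) (B u j)
      (readBit col₁ u fun τ => M (.inl (true, τ)))
      (readBit (col₂ j) u fun τ => M (.inr (.inr (true, τ)))))

/-- The program for clique detection: node `u` learns the adjacency within `S u`, and then, for
the element `j` known to the leader, between `S u` and `B u j`. -/
def cliqueProgram (d : ℕ) (S : Fin n → Finset (Fin n)) (B : Fin n → J → Finset (Fin n))
    (col₁ : Fin n × Fin n × Fin n → Fin T₁ × Fin n)
    (col₂ : J → Fin n × Fin n × Fin n → Fin T₂ × Fin n)
    (leader : Fin n) (j₀ : J) (enc : J → Message b) (dec : Message b → J)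
    (hb : 0 < b) (hdec : Function.LeftInverse dec enc)
    (h₁ : IsRouting (demands S S) col₁) (h₂ : ∀ j, IsRouting (demands S (B · j)) (col₂ j)) :
    Program n b (Slot T₁ T₂) J leader j₀ where
  rank := slotRank
  mem := cliqueMem d S B col₁ col₂ leader j₀ enc
  send := cliqueSend d S B col₁ col₂ leader enc dec
  send_eq s G j u v M hM := by
    -- Every node fills the slot of rank 2 of all others, but only the leader's entry is decoded.
    have hj (h : 2 < slotRank s) : dec (M (.inr (.inl false)) leader) = j := by
      rw [hM (.inr (.inl false)) h]
      simp [cliqueMem, hdec j]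
    match s with
    | .inl (false, τ) => rfl
    | .inl (true, τ) =>
      simp only [cliqueSend, cliqueMem]
      rw [hM (.inl (false, τ)) (by simp [slotRank])]
      simp only [cliqueMem, bitMessage_eq_true_iff hb]
      rfl
    | .inr (.inl false) => rfl
    | .inr (.inr (false, τ)) =>
      simp only [cliqueSend, hj (by simp [slotRank])]
      rfl
    | .inr (.inr (true, τ)) =>
      simp only [cliqueSend, hj (by simp [slotRank]), cliqueMem]
      rw [hM (.inr (.inr (false, τ))) (by simp [slotRank])]
      simp only [cliqueMem, bitMessage_eq_true_iff hb]
      rfl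
    | .inr (.inl true) =>
      simp only [cliqueSend, hj (by simp [slotRank]), cliqueMem]
      congr 1
      refine propext (cliqueFound_congr (fun a ha y hy => ?_) fun a ha w hw => ?_)
      · refine readBit_iff hb h₁ G u _ (fun τ r => ?_) (by simp [demands, ha, hy])
        rw [hM (.inl (true, τ)) (by simp [slotRank])]
        rfl
      · refine readBit_iff hb (h₂ j) G u _ (fun τ r => ?_) (by simp [demands, ha, hw])
        rw [hM (.inr (.inr (true, τ))) (by simp [slotRank])]
        rfl

/-- Clique detection by search, for a family of sets `S u` and `B u j` that covers all cliques. -/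
theorem exists_protocol_of_cover [Fintype J] [DecidableEq J] [Nonempty J] (d : ℕ)
    (S : Fin n → Finset (Fin n)) (B : Fin n → J → Finset (Fin n)) (hn : 0 < n) (hb : 0 < b)
    (hJ : Fintype.card J ≤ 2 ^ b)
    (hcover : ∀ s : Finset (Fin n), s.card = d → ∀ w, ∃ u j, s ⊆ S u ∧ w ∈ B u j)
    (σ L : ℕ) (hS : ∀ u, (S u).card ≤ σ) (hS' : ∀ a, (Finset.univ.filter fun u => a ∈ S u).card ≤ σ)
    (hB : ∀ u j, (B u j).card ≤ L) (E r : ℕ) (hE : Fintype.card J ≤ 9 ^ E) :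
    ∃ A : Protocol n b,
      A.rounds ≤ 10 * (2 * (σ * σ) / n + 1) +
        (E + 1) * (r + 1) * (3 ^ E * (10 * (2 + 2 * (2 * (σ * L) / n + 1)) + 4)) ∧
      ∀ G, 1 - (1 / 2) ^ (r + 1) ≤ A.outputProb G (correctOutputs (d + 1) G) := by
  have hroute (Y : Fin n → Finset (Fin n)) (L : ℕ) (hY : ∀ u, (Y u).card ≤ L) :
      ∃ col : Fin n × Fin n × Fin n → Fin (2 * (σ * L) / n + 1) × Fin n,
        IsRouting (demands S Y) col := by
    -- `σ * L` bounds the load of every receiver, because `S u` is small, and of every sender,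
    -- because each node lies in few sets `S u`.
    refine exists_isRouting _ (σ * L) _ (by positivity) ?_ (fun u => ?_) fun a => ?_
    · rw [mul_comm _ n]
      exact (Nat.lt_mul_div_succ _ hn).le
    · exact (card_demands_dst S Y u).trans (Nat.mul_le_mul (hS u) (hY u))
    · exact (card_demands_src S Y a L hY).trans (Nat.mul_le_mul_right _ (hS' a))
  obtain ⟨col₁, h₁⟩ := hroute S σ hS
  choose col₂ h₂ using fun j => hroute (B · j) L fun u => hB u j
  obtain ⟨enc⟩ : Nonempty (J ↪ Message b) :=
    Function.Embedding.nonempty_of_card_le (by simpa using hJ)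
  obtain ⟨j₀⟩ := ‹Nonempty J›
  have : Nonempty J := ⟨j₀⟩
  set P := cliqueProgram d S B col₁ col₂ ⟨0, hn⟩ j₀ enc (Function.invFun enc) hb
    (Function.leftInverse_invFun enc.injective) h₁ h₂ with hP
  classical
  -- Ranks 0 and 1 are the preparation, independent of `j`; ranks 2 to 5 are recomputed in every
  -- query.
  obtain ⟨A, hA, hprob⟩ := Program.exists_protocol_clique (P := P) (k := 2) (c := 6) (p := d + 1)
    (fun G j v s hs => by
      match s with
      | .inl (false, τ) => rfl
      | .inl (true, τ) => rfl
      | .inr (.inl false) => simp [hP, cliqueProgram, slotRank] at hs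
      | .inr (.inl true) => simp [hP, cliqueProgram, slotRank] at hs
      | .inr (.inr (false, τ)) => simp [hP, cliqueProgram, slotRank] at hs
      | .inr (.inr (true, τ)) => simp [hP, cliqueProgram, slotRank] at hs)
    (by norm_num)
    (fun s => by
      match s with
      | .inl (false, τ) => simp [hP, cliqueProgram, slotRank]
      | .inl (true, τ) => simp [hP, cliqueProgram, slotRank]
      | .inr (.inl false) => simp [hP, cliqueProgram, slotRank]
      | .inr (.inl true) => simp [hP, cliqueProgram, slotRank]
      | .inr (.inr (false, τ)) => simp [hP, cliqueProgram, slotRank]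
      | .inr (.inr (true, τ)) => simp [hP, cliqueProgram, slotRank])
    (fun M => decide (∃ u, M (.inr (.inl true)) u = bitMessage b True))
    (fun G => by
      rw [← exists_cliqueFound_iff hcover G]
      simp [hP, cliqueProgram, cliqueMem, bitMessage_eq_true_iff hb])
    E r hE
  refine ⟨A, hA.trans ?_, hprob⟩
  have hc₁ : P.slotCount 0 2 ≤ 2 * (2 * (σ * σ) / n + 1) := by
    have : Fintype.card (Bool × Fin (2 * (σ * σ) / n + 1)) = 2 * (2 * (σ * σ) / n + 1) := by simp
    rw [← this, ← Finset.card_univ, ← Finset.card_map Function.Embedding.inl]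
    refine Finset.card_le_card fun s hs => ?_
    rcases s with s | x | ⟨x, τ⟩
    · simp
    · cases x <;> simp [hP, cliqueProgram, slotRank] at hs
    · cases x <;> simp [hP, cliqueProgram, slotRank] at hs
  have hc₂ : P.slotCount 2 6 ≤ 2 + 2 * (2 * (σ * L) / n + 1) := by
    have : Fintype.card (Bool ⊕ (Bool × Fin (2 * (σ * L) / n + 1))) =
      2 + 2 * (2 * (σ * L) / n + 1) := by simp
    rw [← this, ← Finset.card_univ, ← Finset.card_map Function.Embedding.inr]
    refine Finset.card_le_card fun s hs => ?_
    rcases s with ⟨x, τ⟩ | s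
    · cases x <;> simp [hP, cliqueProgram, slotRank] at hs
    · simp
  calc 5 * P.slotCount 0 2 + (E + 1) * (r + 1) * (3 ^ E * (10 * P.slotCount 2 6 + 4))
      ≤ 5 * (2 * (2 * (σ * σ) / n + 1)) +
        (E + 1) * (r + 1) * (3 ^ E * (10 * (2 + 2 * (2 * (σ * L) / n + 1)) + 4)) := by gcongr
    _ = _ := by ring

end CliqueProgram

/-! ### Parts, chunks and batches as residue classes -/

lemma card_filter_mod_le (n q x : ℕ) :
    (Finset.univ.filter fun a : Fin n => (a : ℕ) % q = x).card ≤ n / q + 1 := by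
  rw [← Finset.card_range (n / q + 1)]
  refine Finset.card_le_card_of_injOn (fun a => (a : ℕ) / q) (fun a _ => ?_) fun a ha a' ha' h => ?_
  · simp only [Finset.coe_range, Set.mem_Iio]
    exact Nat.lt_succ_of_le (Nat.div_le_div_right a.2.le)
  · simp only [Finset.coe_filter_univ, Set.mem_ofPred_eq] at ha ha'
    refine Fin.ext ?_
    rw [← Nat.div_add_mod (a : ℕ) q, ← Nat.div_add_mod (a' : ℕ) q, ha, ha']
    exact congrArg (fun z => q * z + x) h

lemma card_filter_apply_eq (d q : ℕ) (i : Fin (d + 1)) (x : ℕ) :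
    (Finset.univ.filter fun τ : Fin (d + 1) → Fin q => (τ i : ℕ) = x).card ≤ q ^ d := by
  have : q ^ d = (Finset.univ : Finset (Fin d → Fin q)).card := by simp
  rw [this]
  refine Finset.card_le_card_of_injOn (fun τ => i.removeNth τ) (fun _ _ => Finset.mem_coe.mpr (Finset.mem_univ _))
    fun τ hτ τ' hτ' h => ?_
  simp only [Finset.coe_filter_univ, Set.mem_ofPred_eq] at hτ hτ'
  rw [← i.insertNth_self_removeNth τ, ← i.insertNth_self_removeNth τ',
    show i.removeNth τ = i.removeNth τ' from h, show τ i = τ' i from Fin.ext (hτ.trans hτ'.symm)]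

/-- Clique detection where the nodes correspond to the choices of `d + 1` out of `q` parts of the
set of nodes and of one out of `C` chunks, which is searched in `K` batches. -/
theorem exists_protocol_of_parts {n b : ℕ} (d q C K : ℕ) (hn : 0 < n) (hb : 0 < b) (hq : 0 < q)
    (hC : 0 < C) (hK : 0 < K) (hqC : q ^ (d + 1) * C ≤ n) (hKb : K ≤ 2 ^ b) (E r : ℕ)
    (hE : K ≤ 9 ^ E) (σ L : ℕ) (hσ : σ = (d + 1) * (n / q + 1)) (hL : L = n / (C * K) + 1) :
    ∃ A : Protocol n b,
      A.rounds ≤ 10 * (2 * (σ * σ) / n + 1) +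
        (E + 1) * (r + 1) * (3 ^ E * (10 * (2 + 2 * (2 * (σ * L) / n + 1)) + 4)) ∧
      ∀ G, 1 - (1 / 2) ^ (r + 1) ≤ A.outputProb G (correctOutputs (d + 2) G) := by
  classical
  obtain ⟨ι⟩ : Nonempty ((Fin (d + 1) → Fin q) × Fin C ↪ Fin n) :=
    Function.Embedding.nonempty_of_card_le (by simpa using hqC)
  have : Nonempty (Fin K) := ⟨⟨0, hK⟩⟩
  have hCK : 0 < C * K := Nat.mul_pos hC hK
  refine exists_protocol_of_cover (J := Fin K) (d + 1)
    (fun u => Finset.univ.filter fun a => ∃ τ c, ι (τ, c) = u ∧ ∃ i, (τ i : ℕ) = a % q)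
    (fun u j => Finset.univ.filter fun w => ∃ τ c, ι (τ, c) = u ∧ (w : ℕ) % (C * K) = c + C * j)
    hn hb (by simpa using hKb) (fun s hs w => ?_) σ L (fun u => ?_) (fun a => ?_)
    (fun u j => ?_) E r (by simpa using hE)
  · have e := (s.equivFinOfCardEq hs).symm
    -- The node is named by the parts of the elements of `s` and by the chunk of `w`; the chunk `c`
    -- and the batch `j` are the remainder and the quotient by `C` of `w % (C * K)`.
    let τ : Fin (d + 1) → Fin q := fun i => ⟨((e i : Fin n) : ℕ) % q, Nat.mod_lt _ hq⟩
    let c : Fin C := ⟨(w : ℕ) % (C * K) % C, Nat.mod_lt _ hC⟩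
    let j : Fin K := ⟨(w : ℕ) % (C * K) / C, Nat.div_lt_of_lt_mul (Nat.mod_lt _ hCK)⟩
    refine ⟨ι (τ, c), j, fun a ha => ?_, ?_⟩
    · rw [Finset.mem_filter_univ]
      exact ⟨τ, c, rfl, e.symm ⟨a, ha⟩, by simp [τ]⟩
    · rw [Finset.mem_filter_univ]
      exact ⟨τ, c, rfl, (Nat.mod_add_div _ _).symm⟩
  · by_cases hu : ∃ τ c, ι (τ, c) = u
    · obtain ⟨τ, c, rfl⟩ := hu
      have hsub : (Finset.univ.filter fun a : Fin n => ∃ τ' c', ι (τ', c') = ι (τ, c) ∧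
          ∃ i, (τ' i : ℕ) = a % q) ⊆
          Finset.univ.biUnion fun i => Finset.univ.filter fun a : Fin n => (a : ℕ) % q = τ i := by
        intro a ha
        obtain ⟨τ', c', h, i, hi⟩ := (Finset.mem_filter_univ _).mp ha
        obtain ⟨rfl, -⟩ := Prod.mk.inj (ι.injective h)
        simp only [Finset.mem_biUnion, Finset.mem_univ, true_and, Finset.mem_filter_univ]
        exact ⟨i, hi.symm⟩
      refine (Finset.card_le_card hsub).trans (Finset.card_biUnion_le.trans ?_)
      refine (Finset.sum_le_card_nsmul _ _ _ fun i _ => card_filter_mod_le n q _).trans ?_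
      simp [hσ]
    -- Nodes outside the range of `ι` have an empty set and no task.
    · rw [Finset.filter_eq_empty_iff.mpr]
      · simp
      · rintro a - ⟨τ, c, h, -⟩
        exact hu ⟨τ, c, h⟩
  · have hsub : (Finset.univ.filter fun u : Fin n => a ∈ Finset.univ.filter fun a : Fin n =>
        ∃ τ c, ι (τ, c) = u ∧ ∃ i, (τ i : ℕ) = a % q) ⊆
        ((Finset.univ.biUnion fun i => Finset.univ.filter fun τ : Fin (d + 1) → Fin q =>
          (τ i : ℕ) = a % q) ×ˢ (Finset.univ : Finset (Fin C))).map ι := by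
      intro u hu
      simp only [Finset.mem_filter_univ] at hu
      obtain ⟨τ, c, rfl, i, hi⟩ := hu
      refine Finset.mem_map_of_mem _ (Finset.mem_product.mpr ⟨?_, Finset.mem_univ _⟩)
      simp only [Finset.mem_biUnion, Finset.mem_univ, true_and, Finset.mem_filter_univ]
      exact ⟨i, hi⟩
    refine (Finset.card_le_card hsub).trans ?_
    rw [Finset.card_map, Finset.card_product, Finset.card_univ, Fintype.card_fin]
    have h1 : (Finset.univ.biUnion fun i => Finset.univ.filter fun τ : Fin (d + 1) → Fin q =>
        (τ i : ℕ) = a % q).card ≤ (d + 1) * q ^ d := by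
      refine Finset.card_biUnion_le.trans ?_
      refine (Finset.sum_le_card_nsmul _ _ _ fun i _ => card_filter_apply_eq d q i _).trans ?_
      simp
    -- Fixing one of the parts leaves `q ^ d * C` nodes; as all the names fit into `n` nodes, this
    -- is at most the size of a part, so sender and receiver loads have the same bound.
    have h2 : q ^ d * C ≤ n / q := by
      rw [Nat.le_div_iff_mul_le hq]
      calc q ^ d * C * q = q ^ (d + 1) * C := by ring
        _ ≤ n := hqC
    calc _ ≤ (d + 1) * q ^ d * C := Nat.mul_le_mul_right _ h1
      _ = (d + 1) * (q ^ d * C) := by ring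
      _ ≤ σ := by
        rw [hσ]
        exact Nat.mul_le_mul_left _ (h2.trans (Nat.le_succ _))
  · by_cases hu : ∃ τ c, ι (τ, c) = u
    · obtain ⟨τ, c, rfl⟩ := hu
      rw [hL]
      refine (Finset.card_le_card fun w hw => ?_).trans (card_filter_mod_le n (C * K) (c + C * j))
      obtain ⟨τ', c', h, hmod⟩ := (Finset.mem_filter_univ _).mp hw
      obtain ⟨-, rfl⟩ := Prod.mk.inj (ι.injective h)
      exact (Finset.mem_filter_univ _).mpr hmod
    · rw [Finset.filter_eq_empty_iff.mpr]
      · simp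
      · rintro a - ⟨τ, c, h, -⟩
        exact hu ⟨τ, c, h⟩

/-! ### Rounding and logarithms -/

section Bounds

lemma half_le_floor {y : ℝ} (hy : 1 ≤ y) : y / 2 ≤ ⌊y⌋₊ := by
  have h1 : (1 : ℝ) ≤ ⌊y⌋₊ := by exact_mod_cast Nat.le_floor (by simpa using hy)
  linarith [Nat.lt_floor_add_one y]

lemma clog_two_le {n : ℕ} (hn : 2 ≤ n) : (Nat.clog 2 n : ℝ) ≤ 3 * Real.log n := by
  have h0 := Real.log_two_gt_d9
  have hlog : Real.log 2 ≤ Real.log n :=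
    Real.log_le_log (by norm_num) (by exact_mod_cast hn)
  have h1 : 1 ≤ Nat.clog 2 n := Nat.clog_pos (by norm_num) hn
  have h2 : 2 ^ (Nat.clog 2 n - 1) < n := by
    have := Nat.pow_pred_clog_lt_self (b := 2) (by norm_num) (x := n) (by omega)
    simpa using this
  have h3 : ((Nat.clog 2 n - 1 : ℕ) : ℝ) * Real.log 2 ≤ Real.log n := by
    rw [← Real.log_pow]
    exact Real.log_le_log (by positivity) (by exact_mod_cast h2.le)
  rw [Nat.cast_sub h1, Nat.cast_one] at h3
  have h4 : (Nat.clog 2 n : ℝ) * Real.log 2 ≤ 2 * Real.log n := by linarith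
  have h5 : (0 : ℝ) ≤ Nat.clog 2 n := Nat.cast_nonneg _
  nlinarith

lemma three_pow_clog_nine_le {K : ℕ} (hK : 0 < K) : (3 : ℝ) ^ Nat.clog 9 K ≤ 3 * √K := by
  have hK1 : (1 : ℝ) ≤ K := by exact_mod_cast hK
  rcases Nat.lt_or_ge 1 K with h | h
  · have h2 : 9 ^ (Nat.clog 9 K - 1) < K := by
      have := Nat.pow_pred_clog_lt_self (b := 9) (by norm_num) (x := K) (by omega)
      simpa using this
    have h1 : 1 ≤ Nat.clog 9 K := Nat.clog_pos (by norm_num) h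
    obtain ⟨e, he⟩ := Nat.exists_eq_add_of_le' h1
    rw [he, Nat.add_sub_cancel] at h2
    rw [he, pow_succ, mul_comm]
    gcongr
    refine Real.le_sqrt_of_sq_le ?_
    rw [← pow_mul, mul_comm, pow_mul]
    norm_num
    exact_mod_cast h2.le
  · have : K = 1 := by omega
    subst this
    norm_num

lemma half_pow_le_one_div_pow (n k : ℕ) (hn : 0 < n) :
    (1 / 2 : ℝ) ^ (k * Nat.clog 2 n + 1) ≤ 1 / (n : ℝ) ^ k := by
  have h1 : (n : ℝ) ≤ 2 ^ Nat.clog 2 n := by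
    exact_mod_cast Nat.le_pow_clog (by norm_num) n
  have hn' : (0 : ℝ) < n := by exact_mod_cast hn
  rw [div_pow, one_pow, mul_comm k, pow_succ, pow_mul]
  refine one_div_le_one_div_of_le (by positivity) ?_
  calc (n : ℝ) ^ k ≤ (2 ^ Nat.clog 2 n) ^ k := by gcongr
    _ ≤ (2 ^ Nat.clog 2 n) ^ k * 2 := by
      have : (0 : ℝ) ≤ (2 ^ Nat.clog 2 n) ^ k := by positivity
      linarith

end Bounds

/-! ### From exponents to the complexity -/

lemma outputProb_nonneg {n b : ℕ} (P : Protocol n b) (G : SimpleGraph (Fin n))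
    (E : Set (Fin n → Bool)) : 0 ≤ P.outputProb G E :=
  Finset.sum_nonneg fun _ _ => sq_nonneg _

/-- The exponents `α`, `γ`, `κ` of the numbers of parts, of chunks and of batches give a quantum
protocol for clique detection. -/
theorem exists_protocol_of_exponents (d k : ℕ) (α γ κ e : ℝ) (hα : 0 ≤ α) (hα1 : α ≤ 1)
    (hγ : 0 ≤ γ) (hκ : 0 ≤ κ) (hnodes : (d + 1) * α + γ ≤ 1) (hquery : 1 ≤ α + γ + κ)
    (hγκ : γ + κ ≤ 1) (hload : 1 - 2 * α ≤ e) (hsearch : κ / 2 ≤ e) {n b : ℕ} (hn : 2 ≤ n)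
    (hb : 0 < b) (hnb : n ≤ 2 ^ b) :
    ∃ A : Protocol n b,
      (∀ G, 1 - 1 / (n : ℝ) ^ k ≤ A.outputProb G (correctOutputs (d + 2) G)) ∧
      (A.rounds : ℝ) ≤ (40 * (18 * (d + 1) ^ 2 + 1) + 30 * (3 * k + 2) *
        (10 * (2 + 2 * (18 * (d + 1) + 1)) + 4)) * ((n : ℝ) ^ e * Real.log n ^ 2) := by
  set x : ℝ := (n : ℝ) with hx
  have hx2 : (2 : ℝ) ≤ x := by rw [hx]; exact_mod_cast hn
  have hx1 : (1 : ℝ) ≤ x := by linarith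
  have hx0 : (0 : ℝ) < x := by linarith
  set q := ⌊x ^ α⌋₊ with hq
  set C := ⌊x ^ γ⌋₊ with hC
  set K := ⌈x ^ κ⌉₊ with hK
  have hxα : 1 ≤ x ^ α := Real.one_le_rpow hx1 hα
  have hxγ : 1 ≤ x ^ γ := Real.one_le_rpow hx1 hγ
  have hxκ : 1 ≤ x ^ κ := Real.one_le_rpow hx1 hκ
  have hxe : 1 ≤ x ^ e := Real.one_le_rpow hx1 (by linarith)
  have hq0 : 0 < q := Nat.floor_pos.mpr hxα
  have hC0 : 0 < C := Nat.floor_pos.mpr hxγ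
  have hK0 : 0 < K := Nat.ceil_pos.mpr (by linarith)
  have hqle : (q : ℝ) ≤ x ^ α := Nat.floor_le (by linarith)
  have hCle : (C : ℝ) ≤ x ^ γ := Nat.floor_le (by linarith)
  have hqge : x ^ α / 2 ≤ q := half_le_floor hxα
  have hCge : x ^ γ / 2 ≤ C := half_le_floor hxγ
  have hKge : x ^ κ ≤ K := Nat.le_ceil _
  have hKle : (K : ℝ) ≤ 2 * x ^ κ := by
    have := Nat.ceil_lt_add_one (show 0 ≤ x ^ κ by linarith)
    linarith
  have hKn : K ≤ n := by
    rw [hK, Nat.ceil_le, ← hx]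
    calc x ^ κ ≤ x ^ (1 : ℝ) := Real.rpow_le_rpow_of_exponent_le hx1 (by linarith)
      _ = x := Real.rpow_one x
  have hqC : q ^ (d + 1) * C ≤ n := by
    have : ((q ^ (d + 1) * C : ℕ) : ℝ) ≤ n := by
      push_cast
      calc (q : ℝ) ^ (d + 1) * C ≤ (x ^ α) ^ (d + 1) * x ^ γ := by gcongr
        _ = x ^ ((d + 1) * α + γ) := by
          rw [← Real.rpow_natCast, ← Real.rpow_mul hx0.le, ← Real.rpow_add hx0]
          push_cast
          ring_nf
        _ ≤ x ^ (1 : ℝ) := Real.rpow_le_rpow_of_exponent_le hx1 hnodes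
        _ = n := Real.rpow_one x
    exact_mod_cast this
  -- Powers of three up to about `√K` suffice, and `k * Nat.clog 2 n + 1` repetitions push the error
  -- below `n ^ (-k)`.
  obtain ⟨A, hA, hprob⟩ := exists_protocol_of_parts (b := b) d q C K (by omega) hb hq0 hC0 hK0 hqC
    (hKn.trans hnb) (Nat.clog 9 K) (k * Nat.clog 2 n) (Nat.le_pow_clog (by norm_num) K) _ _ rfl rfl
  refine ⟨A, fun G => le_trans ?_ (hprob G), ?_⟩
  · linarith [half_pow_le_one_div_pow n k (by omega)]
  set σ := (d + 1) * (n / q + 1) with hσ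
  set L := n / (C * K) + 1 with hL
  -- Rounding `x ^ α` down costs a factor 2, and the summand `1` is absorbed into one more `x ^ (1 -
  -- α)`; the bound for `L` arises in the same way.
  have hσle : (σ : ℝ) ≤ 3 * (d + 1) * x ^ (1 - α) := by
    have h1 : ((n / q : ℕ) : ℝ) ≤ 2 * x ^ (1 - α) := by
      refine Nat.cast_div_le.trans ?_
      rw [div_le_iff₀ (by exact_mod_cast hq0)]
      calc (n : ℝ) = x ^ (1 - α) * x ^ α := by
            rw [← Real.rpow_add hx0, sub_add_cancel, Real.rpow_one]
        _ ≤ x ^ (1 - α) * (2 * q) := by gcongr; linarith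
        _ = 2 * x ^ (1 - α) * q := by ring
    have h2 : 1 ≤ x ^ (1 - α) := Real.one_le_rpow hx1 (by linarith)
    rw [hσ]
    push_cast
    calc ((d : ℝ) + 1) * (((n / q : ℕ) : ℝ) + 1) ≤ (d + 1) * (3 * x ^ (1 - α)) := by
          gcongr; linarith
      _ = _ := by ring
  have hLle : (L : ℝ) ≤ 3 * x ^ (1 - γ - κ) := by
    have h1 : ((n / (C * K) : ℕ) : ℝ) ≤ 2 * x ^ (1 - γ - κ) := by
      refine Nat.cast_div_le.trans ?_
      rw [div_le_iff₀ (by exact_mod_cast Nat.mul_pos hC0 hK0), Nat.cast_mul]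
      calc (n : ℝ) = x ^ (1 - γ - κ) * (x ^ γ * x ^ κ) := by
            rw [← Real.rpow_add hx0, ← Real.rpow_add hx0]
            ring_nf
            exact (Real.rpow_one x).symm
        _ ≤ x ^ (1 - γ - κ) * ((2 * C) * K) := by gcongr; linarith
        _ = _ := by ring
    have h2 : 1 ≤ x ^ (1 - γ - κ) := Real.one_le_rpow hx1 (by linarith)
    rw [hL]
    push_cast
    linarith
  have hT₁ : ((2 * (σ * σ) / n + 1 : ℕ) : ℝ) ≤ (18 * (d + 1) ^ 2 + 1) * x ^ e := by
    have h1 : ((2 * (σ * σ) / n : ℕ) : ℝ) ≤ 18 * (d + 1) ^ 2 * x ^ e := by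
      refine Nat.cast_div_le.trans ?_
      rw [div_le_iff₀ hx0]
      push_cast
      calc (2 : ℝ) * (σ * σ) ≤ 2 * ((3 * (d + 1) * x ^ (1 - α)) * (3 * (d + 1) * x ^ (1 - α))) := by
            gcongr
        _ = 18 * (d + 1) ^ 2 * (x ^ (1 - α) * x ^ (1 - α)) := by ring
        _ = 18 * (d + 1) ^ 2 * (x ^ (1 - 2 * α) * x) := by
          congr 1
          nth_rewrite 4 [← Real.rpow_one x]
          rw [← Real.rpow_add hx0, ← Real.rpow_add hx0]
          ring_nf
        _ ≤ 18 * (d + 1) ^ 2 * (x ^ e * x) := by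
          gcongr
        _ = _ := by ring
    push_cast
    linarith
  have hT₂ : ((2 * (σ * L) / n + 1 : ℕ) : ℝ) ≤ 18 * (d + 1) + 1 := by
    have h1 : ((2 * (σ * L) / n : ℕ) : ℝ) ≤ 18 * (d + 1) := by
      refine Nat.cast_div_le.trans ?_
      rw [div_le_iff₀ hx0]
      push_cast
      calc (2 : ℝ) * (σ * L) ≤ 2 * ((3 * (d + 1) * x ^ (1 - α)) * (3 * x ^ (1 - γ - κ))) := by
            gcongr
        _ = 18 * (d + 1) * (x ^ (1 - α) * x ^ (1 - γ - κ)) := by ring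
        _ ≤ 18 * (d + 1) * x ^ (1 : ℝ) := by
          rw [← Real.rpow_add hx0]
          gcongr
          linarith
        _ = _ := by rw [Real.rpow_one]
    push_cast
    linarith
  have hE : (3 : ℝ) ^ Nat.clog 9 K ≤ 6 * x ^ e := by
    refine (three_pow_clog_nine_le hK0).trans ?_
    have : √(K : ℝ) ≤ 2 * x ^ e := by
      refine Real.sqrt_le_iff.mpr ⟨by positivity, ?_⟩
      calc (K : ℝ) ≤ 2 * x ^ κ := hKle
        _ ≤ 2 * x ^ (e + e) := by
          gcongr
          linarith
        _ = 2 * (x ^ e * x ^ e) := by rw [Real.rpow_add hx0]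
        _ ≤ (2 * x ^ e) ^ 2 := by nlinarith
    linarith
  set ℓ := Real.log x with hℓ
  have hℓ1 : 1 ≤ 2 * ℓ := by
    have := Real.log_le_log (by norm_num) hx2
    linarith [Real.log_two_gt_d9]
  have hclog : (Nat.clog 2 n : ℝ) ≤ 3 * ℓ := clog_two_le hn
  have hclogK : (Nat.clog 9 K : ℝ) + 1 ≤ 5 * ℓ := by
    have h1 : Nat.clog 9 K ≤ Nat.clog 2 n :=
      (Nat.clog_mono_right 9 hKn).trans (Nat.clog_anti_left (by norm_num) (by norm_num))
    have h2 : (Nat.clog 9 K : ℝ) ≤ Nat.clog 2 n := by exact_mod_cast h1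
    linarith
  have hr : (k : ℝ) * Nat.clog 2 n + 1 ≤ (3 * k + 2) * ℓ := by
    have : (k : ℝ) * Nat.clog 2 n ≤ k * (3 * ℓ) := by gcongr
    linarith
  have hℓ0 : 0 ≤ ℓ := by linarith
  calc (A.rounds : ℝ) ≤ ((10 * (2 * (σ * σ) / n + 1) + (Nat.clog 9 K + 1) * (k * Nat.clog 2 n + 1) *
        (3 ^ Nat.clog 9 K * (10 * (2 + 2 * (2 * (σ * L) / n + 1)) + 4)) : ℕ) : ℝ) := by
        exact_mod_cast hA
    _ = 10 * ((2 * (σ * σ) / n + 1 : ℕ) : ℝ) + ((Nat.clog 9 K : ℝ) + 1) *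
        ((k : ℝ) * Nat.clog 2 n + 1) * (3 ^ Nat.clog 9 K *
          (10 * (2 + 2 * ((2 * (σ * L) / n + 1 : ℕ) : ℝ)) + 4)) := by push_cast; ring
    _ ≤ 10 * ((18 * (d + 1) ^ 2 + 1) * x ^ e) + (5 * ℓ) * ((3 * k + 2) * ℓ) *
        ((6 * x ^ e) * (10 * (2 + 2 * (18 * (d + 1) + 1)) + 4)) := by gcongr
    -- The preparation has no logarithmic factor; it is multiplied by `(2 * ℓ) ^ 2 ≥ 1` so that both
    -- terms have the same form.
    _ ≤ 10 * ((18 * (d + 1) ^ 2 + 1) * x ^ e) * (2 * ℓ) ^ 2 + (5 * ℓ) * ((3 * k + 2) * ℓ) *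
        ((6 * x ^ e) * (10 * (2 + 2 * (18 * (d + 1) + 1)) + 4)) := by
      refine add_le_add_left (le_mul_of_one_le_right (by positivity) (one_le_pow₀ hℓ1)) _
    _ = _ := by ring

theorem cliqueDetectionIn_of_exponents (d : ℕ) (α γ κ e : ℝ) (hα : 0 ≤ α) (hα1 : α ≤ 1)
    (hγ : 0 ≤ γ) (hκ : 0 ≤ κ) (hnodes : (d + 1) * α + γ ≤ 1) (hquery : 1 ≤ α + γ + κ)
    (hγκ : γ + κ ≤ 1) (hload : 1 - 2 * α ≤ e) (hsearch : κ / 2 ≤ e) :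
    CliqueDetectionIn (d + 2) fun n : ℕ => (n : ℝ) ^ e := by
  intro c hc k
  have h (n : ℕ) : ∃ A : Protocol n (c * Nat.clog 2 n),
      (1 ≤ n → ∀ G, 1 - 1 / (n : ℝ) ^ k ≤ A.outputProb G (correctOutputs (d + 2) G)) ∧
      (2 ≤ n → (A.rounds : ℝ) ≤ (40 * (18 * (d + 1) ^ 2 + 1) + 30 * (3 * k + 2) *
        (10 * (2 + 2 * (18 * (d + 1) + 1)) + 4)) * ((n : ℝ) ^ e * Real.log n ^ 2)) := by
    rcases Nat.lt_or_ge n 2 with hn | hn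
    -- For `n = 1` the required probability is `0`, so any protocol will do.
    · refine ⟨protocolOfRounds (W := Unit) [] () fun _ _ => false, fun h1 G => ?_, by omega⟩
      have : n = 1 := by omega
      subst this
      simpa using outputProb_nonneg _ G _
    · have hclog : 0 < Nat.clog 2 n := Nat.clog_pos (by norm_num) hn
      obtain ⟨A, hA, hA'⟩ := exists_protocol_of_exponents d k α γ κ e hα hα1 hγ hκ hnodes hquery hγκ
        hload hsearch (b := c * Nat.clog 2 n) hn (Nat.mul_pos hc hclog)
        ((Nat.le_pow_clog (by norm_num) n).trans
          (Nat.pow_le_pow_right (by norm_num) (Nat.le_mul_of_pos_left _ hc)))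
      exact ⟨A, fun _ => hA, fun _ => hA'⟩
  choose A hA hA' using h
  refine ⟨A, hA, 2, Asymptotics.IsBigO.of_bound (40 * (18 * (d + 1) ^ 2 + 1) + 30 * (3 * k + 2) *
    (10 * (2 + 2 * (18 * (d + 1) + 1)) + 4)) ?_⟩
  filter_upwards [Filter.eventually_ge_atTop 2] with n hn
  rw [Real.norm_of_nonneg (Nat.cast_nonneg _), Real.norm_of_nonneg (by positivity)]
  exact hA' n hn

end QCC
end

theorem theorem1 :
    QCC.CliqueDetectionIn 3 (fun n : ℕ => (n : ℝ) ^ (1 / 5 : ℝ)) ∧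
    ∀ p : ℕ, 4 ≤ p →
      QCC.CliqueDetectionIn p (fun n : ℕ => (n : ℝ) ^ (1 - 2 / ((p : ℝ) - 1))) := by
  -- For triangles, equality in `2α + γ ≤ 1` and `1 ≤ α + γ + κ` gives `κ = α`; balancing `1 - 2α`
  -- with `α / 2` yields `α = 2/5`.
  refine ⟨QCC.cliqueDetectionIn_of_exponents 1 (2 / 5) (1 / 5) (2 / 5) (1 / 5) (by norm_num)
    (by norm_num) (by norm_num) (by norm_num) (by norm_num) (by norm_num) (by norm_num)
    (by norm_num) (by norm_num), fun p hp => ?_⟩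
  obtain ⟨d, rfl⟩ := Nat.exists_eq_add_of_le' (show 2 ≤ p by omega)
  have hd : (2 : ℝ) ≤ d := by exact_mod_cast (show 2 ≤ d by omega)
  have hp1 : ((d + 2 : ℕ) : ℝ) - 1 = d + 1 := by push_cast; ring
  have h0 : 0 ≤ 1 / ((d : ℝ) + 1) := by positivity
  have h3 : 1 / ((d : ℝ) + 1) ≤ 1 / 3 := one_div_le_one_div_of_le (by norm_num) (by linarith)
  have hmul : ((d : ℝ) + 1) * (1 / (d + 1)) = 1 := mul_one_div_cancel (by linarith)
  have h2 : 2 / ((d : ℝ) + 1) = 2 * (1 / (d + 1)) := by ring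
  rw [hp1, h2]
  -- No chunks are used: with `α = 1 / (p - 1)` all nodes are spent on parts. The search exponent
  -- `(1 - α) / 2` is at most `1 - 2α` since `α ≤ 1/3`, so the preparation dominates.
  exact QCC.cliqueDetectionIn_of_exponents d (1 / (d + 1)) 0 (1 - 1 / (d + 1)) _ h0
    (by linarith) le_rfl (by linarith) (by linarith) (by linarith) (by linarith) le_rfl
    (by linarith)
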